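/- Fix constants $a\ge 0$, $P_1,P_2\in\mathbb R$ and $N>0$. For every $n$ let $X_1,X_2,Z$ be independent zero-mean random vectors in $\mathbb{R}^n$ (all depending on $n$) with $\|X_i\|^2\le nP_i$ almost surely ($i=1,2$) and $Z\sim\mathcal N(0,N\,\mathrm{I}_n)$. Put $X=\sqrt a\,X_1$ and $Y=X_2+Z$, and let $Y^G$ denote a zero-mean white Gaussian vector in $\mathbb{R}^n$ of the same variance $Q=\frac1n\mathbb{E}\|Y\|^2$ as $Y$, i.e. $Y^G\sim\mathcal N(0,Q\,\mathrm{I}_n)$. Let $h$ denote differential entropy and $I$ mutual information (in nats), and write $\rho(U,V)=\mathbb{E}\{U\cdot V\}/\sqrt{\mathbb{E}\|U\|^2\,\mathbb{E}\|V\|^2}$. For real sequences, write $A_n\lesssim B_n$ if there is a positive function $\epsilon(n)\to0$ such that $A_n\le B_n+n\,\epsilon(n)$ for all $n\ge1$. Assume that $Y$ is almost Gaussian, that is, $h(Y^G)\lesssim h(Y)$. Then: 1. In every dimension $n$ there is a $Y^G$, independent of $X$ and defined on the same probability space as $Y$, such that $Y=F(Y^G)$ almost surely for some continuously differentiable $F:\mathbb{R}^n\to\mathbb{R}^n$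 whose Jacobian matrix is everywhere lower triangular with positive diagonal elements (a Knöthe map). 2. Whenever $Y$ and $Y^G$ are coupled by such maps, they are almost linearly dependent: there is a positive function $\epsilon(n)\to 0$ such that $1-|\rho(Y,Y^G)|\le\epsilon(n)$ for all $n\ge 1$, and in fact also $1-\rho(Y,Y^G)\le\epsilon(n)$ for all $n\ge 1$. 3. Whenever $Y^G$ is independent of $X$, both $I(X;X+Y)$ and $I(X;X+Y^G)$ are finite, and $$I(X;X+Y)\lesssim I(X;X+Y^G).$$ -/

import Mathlib

open MeasureTheory ProbabilityTheory Filter Topology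
open scoped ENNReal NNReal

noncomputable section

/-- `A n ≲ B n`: there is a positive function `ε` with `ε n → 0` such that
`A n ≤ B n + n * ε n` in every dimension `n ≥ 1`. -/
def AlmostLE (A B : ℕ → ℝ) : Prop :=
  ∃ ε : ℕ → ℝ, (∀ n, 0 < ε n) ∧ Tendsto ε atTop (𝓝 0) ∧
    ∀ n, 1 ≤ n → A n ≤ B n + n * ε n

/-- Differential entropy (in nats) `h = -∫ p log p` of a law on `ℝⁿ` with Lebesgue density `p`. It is
only applied to laws that are absolutely continuous with `p log p` integrable. -/
def diffEntropy {n : ℕ} (μ : Measure (EuclideanSpace ℝ (Fin n))) : ℝ :=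
  ∫ x, Real.negMulLog (μ.rnDeriv volume x).toReal

/-- Mutual information `I(U;V)` (in nats): the divergence of the joint law of `(U, V)` from the
product of the two marginal laws. -/
def mutualInfo {Ω E F : Type*} [MeasurableSpace Ω] [MeasurableSpace E] [MeasurableSpace F]
    (P : Measure Ω) (U : Ω → E) (V : Ω → F) : ℝ≥0∞ :=
  InformationTheory.klDiv (P.map (fun ω => (U ω, V ω))) ((P.map U).prod (P.map V))

/-- The law of a zero-mean white Gaussian vector of `ℝⁿ`: independent coordinates, each centred
Gaussian with variance `v`. -/
def whiteGaussian (n : ℕ) (v : ℝ≥0) : Measure (EuclideanSpace ℝ (Fin n)) :=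
  (Measure.pi (fun _ : Fin n => gaussianReal 0 v)).map (WithLp.toLp 2)

/-- The variance (average power per coordinate) `E‖U‖² / n` of a zero-mean random vector. -/
def avgPower {n : ℕ} {Ω : Type*} [MeasurableSpace Ω] (P : Measure Ω)
    (U : Ω → EuclideanSpace ℝ (Fin n)) : ℝ≥0 :=
  ((∫ ω, ‖U ω‖ ^ 2 ∂P) / n).toNNReal

/-- `UG` is a version of `U^G`: a white Gaussian vector with the same variance as `U`. -/
def IsWhiteGaussianVersion {n : ℕ} {Ω : Type*} [MeasurableSpace Ω] (P : Measure Ω)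
    (U UG : Ω → EuclideanSpace ℝ (Fin n)) : Prop :=
  Measurable UG ∧ P.map UG = whiteGaussian n (avgPower P U)

/-- A sequence of random vectors `U n` of `ℝⁿ` is almost (white) Gaussian: `h(U) ≳ h(U^G)`. -/
def AlmostGaussian {Ω : ℕ → Type*} [∀ n, MeasurableSpace (Ω n)] (P : ∀ n, Measure (Ω n))
    (U : ∀ n, Ω n → EuclideanSpace ℝ (Fin n)) : Prop :=
  AlmostLE (fun n => diffEntropy (whiteGaussian n (avgPower (P n) (U n))))
    (fun n => diffEntropy ((P n).map (U n)))

/-- Correlation coefficient `ρ(U,V) = E(U·V) / √(E‖U‖² E‖V‖²)`. -/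
def corrCoeff {n : ℕ} {Ω : Type*} [MeasurableSpace Ω] (P : Measure Ω)
    (U V : Ω → EuclideanSpace ℝ (Fin n)) : ℝ :=
  (∫ ω, inner ℝ (U ω) (V ω) ∂P) / √((∫ ω, ‖U ω‖ ^ 2 ∂P) * (∫ ω, ‖V ω‖ ^ 2 ∂P))

/-- Two sequences of random vectors are almost linearly dependent: `1 - |ρ(U,V)| ≤ ε(n) → 0`. -/
def AlmostLinearlyDependent {Ω : ℕ → Type*} [∀ n, MeasurableSpace (Ω n)]
    (P : ∀ n, Measure (Ω n)) (U V : ∀ n, Ω n → EuclideanSpace ℝ (Fin n)) : Prop :=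
  ∃ ε : ℕ → ℝ, (∀ n, 0 < ε n) ∧ Tendsto ε atTop (𝓝 0) ∧
    ∀ n, 1 ≤ n → 1 - |corrCoeff (P n) (U n) (V n)| ≤ ε n

/-- `F` is a triangular change of variables of `ℝⁿ`: it is continuously differentiable and its
Jacobian matrix `(∂F_i/∂x_j)` is lower triangular with positive diagonal at every point. -/
structure IsTriangularChange {n : ℕ}
    (F : EuclideanSpace ℝ (Fin n) → EuclideanSpace ℝ (Fin n)) : Prop where
  contDiff : ContDiff ℝ 1 F
  upper_eq_zero : ∀ x i j, i < j → fderiv ℝ F x (EuclideanSpace.single j 1) i = 0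
  diag_pos : ∀ x i, 0 < fderiv ℝ F x (EuclideanSpace.single i 1) i

/-- `UG` is white Gaussian with the same variance as `U`, and it is coupled with `U` through
the Knöthe map: `U = F(UG)` almost surely for a triangular change of variables `F`. -/
def IsKnotheCoupling {n : ℕ} {Ω : Type*} [MeasurableSpace Ω] (P : Measure Ω)
    (U UG : Ω → EuclideanSpace ℝ (Fin n)) : Prop :=
  IsWhiteGaussianVersion P U UG ∧ ∃ F, IsTriangularChange F ∧ ∀ᵐ ω ∂P, U ω = F (UG ω)

end

/-!
`Y = X₂ + Z` has the density `p(y) = E[γ(y - X₂)]`, a mixture of translates of the Gaussian density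
`γ`. The marginals and the conditional distribution functions of such a mixture are averages of
explicit smooth functions, because `X₂` is bounded; this makes every step below elementary.

*Existence of the coupling.* Let `G` map `y` to the vector of Gaussian quantiles of the conditional
distribution functions of `yᵢ` given `y₁, …, yᵢ₋₁`. It is a `C¹` triangular bijection, the diagonal
entries of its Jacobian telescope so that `γ_Q(G(y)) det G'(y) = p(y)`, and hence `Y^G = G(Y)` is
white Gaussian and `F = G⁻¹` is the Knöthe map (`exists_knothe_map`). Moreover `Y^G` is a function
of `Y`, hence independent of `X`.

*Correlation.* If `Y = F(Y^G)` then `h(Y) - h(Y^G) = ∑ E[log ∂ᵢFᵢ(Y^G)] ≤ ∑ E[∂ᵢFᵢ(Y^G)] - n`, and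
Stein's identity, which for monotone functions is Tonelli's theorem (`stein_identity`), turns the
last sum into `E[Y · Y^G] / Q = n ρ(Y, Y^G)`. So `1 - ρ` is at most the normalised entropy gap
(`IsTriangularChange.entropy_le_integral_inner`, `InterferenceModel.one_sub_corrCoeff_le`).

*Mutual information.* `I(X; X + Y) = h(X + Y) - h(Y)`, so only `h(X + Y) ≲ h(X + Y^G)` is needed.
Let `q` be the density of `X + Y^G`. By Gibbs' inequality `h(X + Y) ≤ -E[log q(X + Y)]`, while
`h(X + Y^G) = -E[log q(X + Y^G)]`. As `X` is bounded, `log q` is locally Lipschitz with a constant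
growing linearly (`log_gaussianMixture_sub_le`), so the two expectations differ by
`O(√n (E‖Y - Y^G‖²)^{1/2})`; under the Knöthe coupling `E‖Y - Y^G‖² = 2 n Q (1 - ρ)`, and the
difference is `n` times a vanishing quantity. An arbitrary `Y^G` independent of `X` yields the same
joint law of `(X, X + Y^G)` as the coupled one.
-/

/-! ### The density of a white Gaussian vector -/

/-- The Lebesgue density of `whiteGaussian n v` (for `v ≠ 0`). -/
noncomputable def whiteDensity (n : ℕ) (v : ℝ≥0) (y : EuclideanSpace ℝ (Fin n)) : ℝ :=
  ∏ i, gaussianPDFReal 0 v (y i)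

lemma contDiff_gaussianPDFReal (v : ℝ≥0) : ContDiff ℝ 1 (gaussianPDFReal 0 v) := by
  unfold gaussianPDFReal
  fun_prop

lemma continuous_gaussianPDFReal (v : ℝ≥0) : Continuous (gaussianPDFReal 0 v) :=
  (contDiff_gaussianPDFReal v).continuous

lemma contDiff_whiteDensity (n : ℕ) (v : ℝ≥0) : ContDiff ℝ 1 (whiteDensity n v) := by
  unfold whiteDensity
  refine contDiff_prod fun i _ => (contDiff_gaussianPDFReal v).comp ?_
  fun_prop

lemma continuous_whiteDensity (n : ℕ) (v : ℝ≥0) : Continuous (whiteDensity n v) :=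
  (contDiff_whiteDensity n v).continuous

lemma whiteDensity_pos (n : ℕ) {v : ℝ≥0} (hv : v ≠ 0) (y : EuclideanSpace ℝ (Fin n)) :
    0 < whiteDensity n v y :=
  Finset.prod_pos fun _ _ => gaussianPDFReal_pos _ _ _ hv

lemma whiteDensity_eq_exp (n : ℕ) (v : ℝ≥0) (y : EuclideanSpace ℝ (Fin n)) :
    whiteDensity n v y = (√(2 * Real.pi * v))⁻¹ ^ n * Real.exp (-‖y‖ ^ 2 / (2 * v)) := by
  simp only [whiteDensity, gaussianPDFReal, sub_zero, Finset.prod_mul_distrib, Finset.prod_const,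
    Finset.card_univ, Fintype.card_fin, ← Real.exp_sum, EuclideanSpace.norm_sq_eq,
    Real.norm_eq_abs, sq_abs, ← Finset.sum_div, Finset.sum_neg_distrib]

lemma pi_gaussianReal_eq_withDensity (n : ℕ) {v : ℝ≥0} (hv : v ≠ 0) :
    Measure.pi (fun _ : Fin n => gaussianReal 0 v) =
      (volume : Measure (Fin n → ℝ)).withDensity
        (fun x => ENNReal.ofReal (∏ i, gaussianPDFReal 0 v (x i))) := by
  refine Measure.pi_eq (μ := fun _ : Fin n => gaussianReal 0 v) fun s hs => ?_
  rw [withDensity_apply _ (MeasurableSet.univ_pi hs), volume_pi, Measure.restrict_pi_pi,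
    ← ofReal_integral_eq_lintegral_ofReal, integral_fintype_prod_eq_prod,
    ENNReal.ofReal_prod_of_nonneg]
  · exact Finset.prod_congr rfl fun i _ => (gaussianReal_apply_eq_integral 0 hv (s i)).symm
  · exact fun i _ => integral_nonneg fun x => gaussianPDFReal_nonneg _ _ _
  · exact Integrable.fintype_prod fun i => (integrable_gaussianPDFReal 0 v).restrict
  · exact ae_of_all _ fun x => Finset.prod_nonneg fun i _ => gaussianPDFReal_nonneg _ _ _

lemma whiteGaussian_eq_withDensity (n : ℕ) {v : ℝ≥0} (hv : v ≠ 0) :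
    whiteGaussian n v = volume.withDensity (fun y => ENNReal.ofReal (whiteDensity n v y)) := by
  unfold whiteGaussian
  rw [pi_gaussianReal_eq_withDensity n hv]
  ext s hs
  have hm : Measurable (WithLp.toLp 2 : (Fin n → ℝ) → EuclideanSpace ℝ (Fin n)) := by fun_prop
  rw [Measure.map_apply hm hs, withDensity_apply _ (hm hs), withDensity_apply _ hs]
  exact (PiLp.volume_preserving_toLp (Fin n)).setLIntegral_comp_preimage hs
    (f := fun y => ENNReal.ofReal (whiteDensity n v y))
    (continuous_whiteDensity n v).measurable.ennreal_ofReal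

instance isProbabilityMeasure_whiteGaussian (n : ℕ) (v : ℝ≥0) :
    IsProbabilityMeasure (whiteGaussian n v) :=
  Measure.isProbabilityMeasure_map (by fun_prop)

lemma integrable_comp_apply_whiteGaussian {n : ℕ} {v : ℝ≥0} (i : Fin n) {f : ℝ → ℝ}
    (hf : Measurable f) (h : Integrable f (gaussianReal 0 v)) :
    Integrable (fun y => f (y i)) (whiteGaussian n v) := by
  have hm : Measurable (fun y : EuclideanSpace ℝ (Fin n) => f (y i)) := hf.comp (by fun_prop)
  rw [whiteGaussian, integrable_map_measure hm.aestronglyMeasurable (by fun_prop)]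
  exact integrable_comp_eval (μ := fun _ : Fin n => gaussianReal 0 v) (i := i) h

lemma integral_comp_apply_whiteGaussian {n : ℕ} {v : ℝ≥0} (i : Fin n) {f : ℝ → ℝ}
    (hf : Measurable f) :
    ∫ y, f (y i) ∂(whiteGaussian n v) = ∫ t, f t ∂(gaussianReal 0 v) := by
  have hm : Measurable (fun y : EuclideanSpace ℝ (Fin n) => f (y i)) := hf.comp (by fun_prop)
  rw [whiteGaussian, integral_map (by fun_prop) hm.aestronglyMeasurable]
  exact integral_comp_eval (μ := fun _ : Fin n => gaussianReal 0 v) (i := i)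
    hf.aestronglyMeasurable

lemma integrable_sq_gaussianReal (v : ℝ≥0) : Integrable (fun t : ℝ => t ^ 2) (gaussianReal 0 v) :=
  (memLp_id_gaussianReal (μ := 0) (v := v) 2).integrable_sq

lemma integral_sq_gaussianReal (v : ℝ≥0) : ∫ t, t ^ 2 ∂(gaussianReal 0 v) = v := by
  have h := variance_fun_id_gaussianReal (μ := 0) (v := v)
  rw [variance_eq_integral (by fun_prop)] at h
  simpa using h

lemma integrable_norm_sq_whiteGaussian (n : ℕ) (v : ℝ≥0) :
    Integrable (fun y => ‖y‖ ^ 2) (whiteGaussian n v) := by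
  simp only [EuclideanSpace.norm_sq_eq, Real.norm_eq_abs, sq_abs]
  exact integrable_finsetSum _ fun i _ =>
    integrable_comp_apply_whiteGaussian i (by fun_prop) (integrable_sq_gaussianReal v)

lemma integral_norm_sq_whiteGaussian (n : ℕ) (v : ℝ≥0) :
    ∫ y, ‖y‖ ^ 2 ∂(whiteGaussian n v) = n * v := by
  simp only [EuclideanSpace.norm_sq_eq, Real.norm_eq_abs, sq_abs]
  rw [integral_finsetSum _ fun i _ =>
    integrable_comp_apply_whiteGaussian i (by fun_prop) (integrable_sq_gaussianReal v)]
  simp only [fun i : Fin n => integral_comp_apply_whiteGaussian (v := v) i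
    (f := fun t => t ^ 2) (by fun_prop), integral_sq_gaussianReal]
  simp

/-! ### Gaussian mixtures -/

/-- The density of the sum of independent vectors of law `μ` and `whiteGaussian n v`. -/
noncomputable def gaussianMixture {n : ℕ} (μ : Measure (EuclideanSpace ℝ (Fin n))) (v : ℝ≥0)
    (y : EuclideanSpace ℝ (Fin n)) : ℝ :=
  ∫ x, whiteDensity n v (y - x) ∂μ

lemma restrict_closedBall_eq_self {E : Type*} [NormedAddCommGroup E] [MeasurableSpace E]
    {μ : Measure E} {R : ℝ} (hμ : ∀ᵐ x ∂μ, ‖x‖ ≤ R) : μ.restrict (Metric.closedBall 0 R) = μ :=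
  Measure.restrict_eq_self_of_ae_mem (by simpa using hμ)

section Mollify

variable {E : Type*} [NormedAddCommGroup E] [NormedSpace ℝ E] [FiniteDimensional ℝ E]
  [MeasurableSpace E] [BorelSpace E] {μ : Measure E} [IsFiniteMeasure μ] {R : ℝ}

lemma continuous_integral_sub {G : Type*} [NormedAddCommGroup G] [NormedSpace ℝ G]
    (hμ : ∀ᵐ x ∂μ, ‖x‖ ≤ R) {f : E → G} (hf : Continuous f) :
    Continuous (fun y => ∫ x, f (y - x) ∂μ) := by
  have : ProperSpace E := FiniteDimensional.proper_real E
  have h := continuous_parametric_integral_of_continuous (μ := μ)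
    (f := fun y x => f (y - x)) (by unfold Function.uncurry; fun_prop)
    (isCompact_closedBall (0 : E) R)
  simpa only [restrict_closedBall_eq_self hμ] using h

lemma integrable_sub_of_continuous {G : Type*} [NormedAddCommGroup G]
    (hμ : ∀ᵐ x ∂μ, ‖x‖ ≤ R) {f : E → G} (hf : Continuous f) (y : E) :
    Integrable (fun x => f (y - x)) μ := by
  have : ProperSpace E := FiniteDimensional.proper_real E
  have hc : Continuous (fun x => f (y - x)) := by fun_prop
  have h := hc.continuousOn.integrableOn_compact (μ := μ) (isCompact_closedBall (0 : E) R)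
  rwa [IntegrableOn, restrict_closedBall_eq_self hμ] at h

lemma hasFDerivAt_integral_sub (hμ : ∀ᵐ x ∂μ, ‖x‖ ≤ R) {f : E → ℝ} (hf : ContDiff ℝ 1 f) (y : E) :
    HasFDerivAt (fun y => ∫ x, f (y - x) ∂μ) (∫ x, fderiv ℝ f (y - x) ∂μ) y := by
  have : ProperSpace E := FiniteDimensional.proper_real E
  have hf' : Continuous (fderiv ℝ f) := hf.continuous_fderiv one_ne_zero
  obtain ⟨M, hM⟩ := (isCompact_closedBall (0 : E) (‖y‖ + 1 + R)).exists_bound_of_continuousOn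
    hf'.continuousOn
  refine hasFDerivAt_integral_of_dominated_of_fderiv_le (F' := fun y x => fderiv ℝ f (y - x))
    (bound := fun _ => M) (Metric.ball_mem_nhds y one_pos) ?_
    (integrable_sub_of_continuous hμ hf.continuous y) ?_ ?_ (integrable_const M) ?_
  · exact Eventually.of_forall fun z =>
      (integrable_sub_of_continuous hμ hf.continuous z).aestronglyMeasurable
  · exact (integrable_sub_of_continuous hμ hf' y).aestronglyMeasurable
  · filter_upwards [hμ] with x hx z hz
    refine hM _ ?_
    rw [mem_closedBall_zero_iff]
    have h1 : ‖z - x‖ ≤ ‖z - y‖ + ‖y‖ + ‖x‖ := by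
      calc ‖z - x‖ = ‖(z - y) + y - x‖ := by congr 1; abel
        _ ≤ _ := (norm_sub_le _ _).trans (by gcongr; exact norm_add_le _ _)
    rw [mem_ball_iff_norm] at hz
    linarith
  · refine ae_of_all _ fun x z _ => ?_
    have h := (hf.differentiable one_ne_zero (z - x)).hasFDerivAt.comp z
      ((hasFDerivAt_id z).sub_const x)
    simpa [Function.comp_def] using h

/-- Averaging the translates of a `C¹` function over a boundedly supported measure gives a `C¹`
function. -/
lemma contDiff_integral_sub (hμ : ∀ᵐ x ∂μ, ‖x‖ ≤ R) {f : E → ℝ} (hf : ContDiff ℝ 1 f) :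
    ContDiff ℝ 1 (fun y => ∫ x, f (y - x) ∂μ) := by
  rw [contDiff_one_iff_hasFDerivAt]
  exact ⟨_, continuous_integral_sub hμ (hf.continuous_fderiv one_ne_zero),
    hasFDerivAt_integral_sub hμ hf⟩

end Mollify

section GaussianMixture

variable {n : ℕ} {μ : Measure (EuclideanSpace ℝ (Fin n))} [IsProbabilityMeasure μ] {v : ℝ≥0}
  {R : ℝ}

lemma contDiff_gaussianMixture (hμ : ∀ᵐ x ∂μ, ‖x‖ ≤ R) : ContDiff ℝ 1 (gaussianMixture μ v) :=
  contDiff_integral_sub hμ (contDiff_whiteDensity n v)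

lemma measurable_gaussianMixture (hμ : ∀ᵐ x ∂μ, ‖x‖ ≤ R) : Measurable (gaussianMixture μ v) :=
  (contDiff_gaussianMixture hμ).continuous.measurable

lemma integrable_whiteDensity_sub (hμ : ∀ᵐ x ∂μ, ‖x‖ ≤ R) (y : EuclideanSpace ℝ (Fin n)) :
    Integrable (fun x => whiteDensity n v (y - x)) μ :=
  integrable_sub_of_continuous hμ (continuous_whiteDensity n v) y

lemma gaussianMixture_le (hμ : ∀ᵐ x ∂μ, ‖x‖ ≤ R) (y : EuclideanSpace ℝ (Fin n)) :
    gaussianMixture μ v y ≤ (√(2 * Real.pi * v))⁻¹ ^ n := by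
  calc gaussianMixture μ v y ≤ ∫ _, (√(2 * Real.pi * v))⁻¹ ^ n ∂μ := by
        refine integral_mono (integrable_whiteDensity_sub hμ y) (integrable_const _) fun x => ?_
        rw [whiteDensity_eq_exp]
        refine mul_le_of_le_one_right (by positivity) (Real.exp_le_one_iff.2 ?_)
        exact div_nonpos_of_nonpos_of_nonneg (by simp) (by positivity)
    _ = _ := by simp

lemma le_gaussianMixture (hμ : ∀ᵐ x ∂μ, ‖x‖ ≤ R) (y : EuclideanSpace ℝ (Fin n)) :
    (√(2 * Real.pi * v))⁻¹ ^ n * Real.exp (-(‖y‖ + R) ^ 2 / (2 * v)) ≤ gaussianMixture μ v y := by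
  calc _ = ∫ _, (√(2 * Real.pi * v))⁻¹ ^ n * Real.exp (-(‖y‖ + R) ^ 2 / (2 * v)) ∂μ := by simp
    _ ≤ gaussianMixture μ v y := by
        refine integral_mono_ae (integrable_const _) (integrable_whiteDensity_sub hμ y) ?_
        filter_upwards [hμ] with x hx
        rw [whiteDensity_eq_exp]
        have := norm_sub_le y x
        gcongr
        linarith

lemma gaussianMixture_pos (hv : v ≠ 0) (hμ : ∀ᵐ x ∂μ, ‖x‖ ≤ R) (y : EuclideanSpace ℝ (Fin n)) :
    0 < gaussianMixture μ v y := by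
  have : (0 : ℝ) < v := by positivity
  exact lt_of_lt_of_le (by positivity) (le_gaussianMixture hμ y)

/-- The logarithm of a Gaussian mixture grows at most quadratically, so it is integrable against
every law with a finite second moment. -/
lemma abs_log_gaussianMixture_le (hv : v ≠ 0) (hμ : ∀ᵐ x ∂μ, ‖x‖ ≤ R)
    (y : EuclideanSpace ℝ (Fin n)) :
    |Real.log (gaussianMixture μ v y)| ≤
      |Real.log ((√(2 * Real.pi * v))⁻¹ ^ n)| + R ^ 2 / v + ‖y‖ ^ 2 / v := by
  have hv' : (0 : ℝ) < v := by positivity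
  have hc : 0 < (√(2 * Real.pi * v))⁻¹ ^ n := by positivity
  have h1 := Real.log_le_log (gaussianMixture_pos hv hμ y) (gaussianMixture_le hμ y)
  have h2 := Real.log_le_log (by positivity) (le_gaussianMixture (v := v) hμ y)
  rw [Real.log_mul hc.ne' (Real.exp_pos _).ne', Real.log_exp] at h2
  have h3 : (‖y‖ + R) ^ 2 / (2 * v) ≤ R ^ 2 / v + ‖y‖ ^ 2 / v := by
    rw [← add_div, div_le_div_iff₀ (by positivity) hv']
    nlinarith [sq_nonneg (‖y‖ - R), mul_nonneg hv'.le (sq_nonneg (‖y‖ - R))]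
  have h4 := neg_abs_le (Real.log ((√(2 * Real.pi * v))⁻¹ ^ n))
  have h5 := le_abs_self (Real.log ((√(2 * Real.pi * v))⁻¹ ^ n))
  have h6 : 0 ≤ R ^ 2 / v + ‖y‖ ^ 2 / v := by positivity
  rw [neg_div] at h2
  rw [abs_le]
  constructor <;> linarith

lemma integrable_log_gaussianMixture_comp (hv : v ≠ 0) (hμ : ∀ᵐ x ∂μ, ‖x‖ ≤ R)
    {Ω : Type*} [MeasurableSpace Ω] {P : Measure Ω} [IsFiniteMeasure P]
    {U : Ω → EuclideanSpace ℝ (Fin n)} (hU : AEMeasurable U P)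
    (hint : Integrable (fun ω => ‖U ω‖ ^ 2) P) :
    Integrable (fun ω => Real.log (gaussianMixture μ v (U ω))) P := by
  refine Integrable.mono' ((integrable_const
    (|Real.log ((√(2 * Real.pi * v))⁻¹ ^ n)| + R ^ 2 / v)).add (hint.div_const (v : ℝ)))
    ((measurable_gaussianMixture hμ).log.comp_aemeasurable hU).aestronglyMeasurable
    (ae_of_all _ fun ω => ?_)
  exact abs_log_gaussianMixture_le hv hμ (U ω)

/-- The logarithm of a Gaussian mixture is locally Lipschitz, with a constant that grows linearly:
this already holds for each of the Gaussian kernels that are averaged. -/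
lemma log_gaussianMixture_sub_le (hv : v ≠ 0) (hμ : ∀ᵐ x ∂μ, ‖x‖ ≤ R)
    (y z : EuclideanSpace ℝ (Fin n)) :
    Real.log (gaussianMixture μ v y) - Real.log (gaussianMixture μ v z) ≤
      ‖z - y‖ * (‖z‖ + ‖y‖ + 2 * R) / (2 * v) := by
  have hv' : (0 : ℝ) < v := by positivity
  have key : gaussianMixture μ v y ≤
      Real.exp (‖z - y‖ * (‖z‖ + ‖y‖ + 2 * R) / (2 * v)) * gaussianMixture μ v z := by
    rw [gaussianMixture, gaussianMixture, ← integral_const_mul]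
    refine integral_mono_ae (integrable_whiteDensity_sub hμ y)
      ((integrable_whiteDensity_sub hμ z).const_mul _) ?_
    filter_upwards [hμ] with x hx
    rw [whiteDensity_eq_exp, whiteDensity_eq_exp, mul_left_comm, ← Real.exp_add]
    gcongr
    rw [← add_div]
    gcongr
    have h1 : ‖z - x‖ ^ 2 - ‖y - x‖ ^ 2 = inner ℝ (z - y) ((z - x) + (y - x)) := by
      have h : z - y = (z - x) - (y - x) := by abel
      rw [h, inner_sub_left, inner_add_right, inner_add_right, real_inner_self_eq_norm_sq,
        real_inner_self_eq_norm_sq, real_inner_comm (y - x) (z - x)]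
      ring
    have h2 : inner ℝ (z - y) ((z - x) + (y - x)) ≤ ‖z - y‖ * (‖z‖ + ‖y‖ + 2 * R) := by
      refine (real_inner_le_norm _ _).trans ?_
      gcongr
      have := norm_add_le (z - x) (y - x)
      have := norm_sub_le z x
      have := norm_sub_le y x
      linarith
    linarith
  rw [sub_le_iff_le_add]
  calc Real.log (gaussianMixture μ v y) ≤ _ := Real.log_le_log (gaussianMixture_pos hv hμ y) key
    _ = _ := by rw [Real.log_mul (Real.exp_pos _).ne' (gaussianMixture_pos hv hμ z).ne',
      Real.log_exp]

lemma ofReal_gaussianMixture (hμ : ∀ᵐ x ∂μ, ‖x‖ ≤ R) (y : EuclideanSpace ℝ (Fin n)) :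
    ENNReal.ofReal (gaussianMixture μ v y) = ∫⁻ x, ENNReal.ofReal (whiteDensity n v (y - x)) ∂μ :=
  ofReal_integral_eq_lintegral_ofReal (integrable_whiteDensity_sub hμ y)
    (ae_of_all _ fun _ => Finset.prod_nonneg fun _ _ => gaussianPDFReal_nonneg _ _ _)

/-- The law of the sum of a bounded vector and an independent white Gaussian vector. -/
lemma map_add_eq_withDensity_gaussianMixture (hv : v ≠ 0)
    {Ω : Type*} [MeasurableSpace Ω] {P : Measure Ω} [IsProbabilityMeasure P]
    {W G : Ω → EuclideanSpace ℝ (Fin n)} (hW : Measurable W) (hG : Measurable G)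
    (hWG : IndepFun W G P) (hR : ∀ᵐ ω ∂P, ‖W ω‖ ≤ R) (hlaw : P.map G = whiteGaussian n v) :
    P.map (fun ω => W ω + G ω) =
      volume.withDensity (fun y => ENNReal.ofReal (gaussianMixture (P.map W) v y)) := by
  have : IsProbabilityMeasure (P.map W) := Measure.isProbabilityMeasure_map hW.aemeasurable
  have hR' : ∀ᵐ x ∂(P.map W), ‖x‖ ≤ R := by
    rwa [ae_map_iff hW.aemeasurable (measurableSet_le measurable_norm measurable_const)]
  have hd := (continuous_whiteDensity n v).measurable
  ext s hs
  have hmap : P.map (fun ω => W ω + G ω) =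
      ((P.map W).prod (P.map G)).map (fun z => z.1 + z.2) := by
    rw [← (indepFun_iff_map_prod_eq_prod_map_map hW.aemeasurable hG.aemeasurable).1 hWG,
      Measure.map_map (by fun_prop) (by fun_prop)]
    rfl
  have hadd : Measurable fun z : EuclideanSpace ℝ (Fin n) × EuclideanSpace ℝ (Fin n) =>
    z.1 + z.2 := by fun_prop
  rw [hmap, Measure.map_apply hadd hs, Measure.prod_apply (hadd hs), withDensity_apply _ hs]
  simp_rw [ofReal_gaussianMixture hR']
  rw [lintegral_lintegral_swap]
  · refine lintegral_congr fun x => ?_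
    have hx : MeasurableSet (Prod.mk x ⁻¹'
        ((fun z : EuclideanSpace ℝ (Fin n) × EuclideanSpace ℝ (Fin n) => z.1 + z.2) ⁻¹' s)) :=
      measurable_prodMk_left (hadd hs)
    rw [hlaw, whiteGaussian_eq_withDensity n hv, withDensity_apply _ hx, ← lintegral_indicator hx,
      ← lintegral_indicator hs, ← lintegral_add_left_eq_self (fun y => s.indicator
        (fun y => ENNReal.ofReal (whiteDensity n v (y - x))) y) x]
    refine lintegral_congr fun g => ?_
    by_cases h : x + g ∈ s <;> simp [Set.indicator, h]
  · exact (Measurable.ennreal_ofReal (by fun_prop)).aemeasurable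

end GaussianMixture

/-! ### Triangular changes of variables -/

section Triangular

variable {n : ℕ} {F : EuclideanSpace ℝ (Fin n) → EuclideanSpace ℝ (Fin n)}

lemma clm_apply_eq_sum_single (L : EuclideanSpace ℝ (Fin n) →L[ℝ] EuclideanSpace ℝ (Fin n))
    (w : EuclideanSpace ℝ (Fin n)) (i : Fin n) :
    L w i = ∑ j, w j * L (EuclideanSpace.single j 1) i := by
  have hw : w = ∑ j, w j • EuclideanSpace.single j (1 : ℝ) := by
    ext k
    simp [Finset.sum_apply, Pi.single_apply]
  conv_lhs => rw [hw]
  simp [map_sum, Finset.sum_apply]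

lemma hasDerivAt_line_apply {x : EuclideanSpace ℝ (Fin n)} (hF : DifferentiableAt ℝ F x)
    (w : EuclideanSpace ℝ (Fin n)) (i : Fin n) :
    HasDerivAt (fun t : ℝ => F (x + t • w) i) (fderiv ℝ F x w i) 0 := by
  have h := hF.hasFDerivAt.hasLineDerivAt w
  unfold HasLineDerivAt at h
  have h2 := (EuclideanSpace.proj (𝕜 := ℝ) i).hasFDerivAt.comp_hasDerivAt (0 : ℝ) h
  exact h2

namespace IsTriangularChange

lemma differentiable (hF : IsTriangularChange F) : Differentiable ℝ F :=
  hF.contDiff.differentiable one_ne_zero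

lemma hasDerivAt_line (hF : IsTriangularChange F) (x w : EuclideanSpace ℝ (Fin n)) (i : Fin n)
    (t : ℝ) :
    HasDerivAt (fun t : ℝ => F (x + t • w) i) (fderiv ℝ F (x + t • w) w i) t := by
  have h1 : HasDerivAt (fun t : ℝ => x + t • w) w t := by
    simpa using ((hasDerivAt_id t).smul_const w).const_add x
  have h2 := (hF.differentiable (x + t • w)).hasFDerivAt.comp_hasDerivAt t h1
  exact (EuclideanSpace.proj (𝕜 := ℝ) i).hasFDerivAt.comp_hasDerivAt t h2

/-- The `i`-th component of a triangular change depends only on the first `i` coordinates. -/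
lemma apply_eq_of_forall_le (hF : IsTriangularChange F) {x y : EuclideanSpace ℝ (Fin n)}
    {i : Fin n} (h : ∀ k ≤ i, x k = y k) : F x i = F y i := by
  have h0 : ∀ t, deriv (fun t : ℝ => F (x + t • (y - x)) i) t = 0 := fun t => by
    rw [(hF.hasDerivAt_line x (y - x) i t).deriv, clm_apply_eq_sum_single]
    refine Finset.sum_eq_zero fun j _ => ?_
    rcases le_or_gt j i with hj | hj
    · simp [h j hj]
    · rw [hF.upper_eq_zero _ i j hj, mul_zero]
  have h1 := is_const_of_deriv_eq_zero
    (fun t => (hF.hasDerivAt_line x (y - x) i t).differentiableAt) h0 0 1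
  simpa using h1

lemma apply_lt_of_lt (hF : IsTriangularChange F) {x y : EuclideanSpace ℝ (Fin n)}
    {i : Fin n} (h : ∀ k < i, x k = y k) (hi : x i < y i) : F x i < F y i := by
  have h0 : ∀ t, 0 < deriv (fun t : ℝ => F (x + t • (y - x)) i) t := fun t => by
    rw [(hF.hasDerivAt_line x (y - x) i t).deriv, clm_apply_eq_sum_single]
    rw [Finset.sum_eq_single i]
    · exact mul_pos (by simpa using hi) (hF.diag_pos _ _)
    · intro j _ hj
      rcases lt_or_gt_of_ne hj with hj | hj
      · simp [h j hj]
      · rw [hF.upper_eq_zero _ i j hj, mul_zero]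
    · simp
  have h1 := strictMono_of_deriv_pos h0 zero_lt_one
  simpa using h1

/-- The first `i` components of a triangular change determine the first `i` coordinates. -/
lemma eq_of_forall_le (hF : IsTriangularChange F) {x y : EuclideanSpace ℝ (Fin n)}
    {i : Fin n} (h : ∀ k ≤ i, F x k = F y k) : x i = y i := by
  induction i using WellFoundedLT.induction with
  | _ i ih =>
    have hlt : ∀ k < i, x k = y k := fun k hk => ih k hk fun l hl => h l (hl.trans hk.le)
    rcases lt_trichotomy (x i) (y i) with hi | hi | hi
    · exact absurd (h i le_rfl) (hF.apply_lt_of_lt hlt hi).ne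
    · exact hi
    · exact absurd (h i le_rfl) (hF.apply_lt_of_lt (fun k hk => (hlt k hk).symm) hi).ne'

lemma injective (hF : IsTriangularChange F) : Function.Injective F := fun x y h => by
  ext i
  exact hF.eq_of_forall_le fun k _ => by rw [h]

lemma det_fderiv (hF : IsTriangularChange F) (x : EuclideanSpace ℝ (Fin n)) :
    (fderiv ℝ F x).det = ∏ i, fderiv ℝ F x (EuclideanSpace.single i 1) i := by
  have h : ∀ i j, LinearMap.toMatrix (EuclideanSpace.basisFun (Fin n) ℝ).toBasis
      (EuclideanSpace.basisFun (Fin n) ℝ).toBasis (fderiv ℝ F x).toLinearMap i j =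
      fderiv ℝ F x (EuclideanSpace.single j 1) i := fun i j => by
    simp [LinearMap.toMatrix_apply]
  rw [ContinuousLinearMap.det, ← LinearMap.det_toMatrix
    (EuclideanSpace.basisFun (Fin n) ℝ).toBasis, Matrix.det_of_isLowerTriangular]
  · exact Finset.prod_congr rfl fun i _ => h i i
  · intro i j hij
    rw [h]
    exact hF.upper_eq_zero _ _ _ hij

lemma det_fderiv_pos (hF : IsTriangularChange F) (x : EuclideanSpace ℝ (Fin n)) :
    0 < (fderiv ℝ F x).det := by
  rw [hF.det_fderiv]
  exact Finset.prod_pos fun i _ => hF.diag_pos x i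

/-- The inverse of a surjective triangular change is again a triangular change. -/
lemma exists_inverse (hF : IsTriangularChange F) (hs : Function.Surjective F) :
    ∃ G, IsTriangularChange G ∧ (∀ x, G (F x) = x) ∧ ∀ y, F (G y) = y := by
  let A : EuclideanSpace ℝ (Fin n) →
      (EuclideanSpace ℝ (Fin n) ≃L[ℝ] EuclideanSpace ℝ (Fin n)) := fun x =>
    (fderiv ℝ F x).toContinuousLinearEquivOfDetNeZero (hF.det_fderiv_pos x).ne'
  have hA : ∀ x, HasFDerivAt F (A x : _ →L[ℝ] _) x := fun x =>
    (hF.differentiable x).hasFDerivAt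
  have hopen : IsOpenMap F := isOpenMap_of_hasStrictFDerivAt_equiv (f' := A) fun x =>
    hF.contDiff.contDiffAt.hasStrictFDerivAt' (hA x) one_ne_zero
  let e := (Equiv.ofBijective F ⟨hF.injective, hs⟩).toHomeomorphOfContinuousOpen
    hF.contDiff.continuous hopen
  have hl : ∀ x, e.symm (F x) = x := e.symm_apply_apply
  have hr : ∀ y, F (e.symm y) = y := e.apply_symm_apply
  have hC : ContDiff ℝ 1 e.symm := e.contDiff_symm hA hF.contDiff
  have hD : Differentiable ℝ e.symm := hC.differentiable one_ne_zero
  have hup : ∀ y i j, i < j → fderiv ℝ e.symm y (EuclideanSpace.single j 1) i = 0 := by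
    intro y i j hij
    have h3 : (fun t : ℝ => e.symm (y + t • EuclideanSpace.single j (1 : ℝ)) i) =
        fun _ => e.symm y i := by
      funext t
      refine hF.eq_of_forall_le fun k hk => ?_
      simp [hr, (hk.trans_lt hij).ne]
    have h4 := hasDerivAt_line_apply (hD y) (EuclideanSpace.single j 1) i
    rw [h3] at h4
    exact h4.unique (hasDerivAt_const _ _)
  refine ⟨e.symm, ⟨hC, hup, fun y i => ?_⟩, hl, hr⟩
  -- the diagonal entries of two inverse lower triangular matrices are inverse to each other
  have hcomp : (fderiv ℝ F (e.symm y)).comp (fderiv ℝ e.symm y) = ContinuousLinearMap.id ℝ _ := by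
    have h := (hF.differentiable (e.symm y)).hasFDerivAt.comp y (hD y).hasFDerivAt
    rw [show F ∘ e.symm = id from funext hr] at h
    exact h.unique (hasFDerivAt_id y)
  have h1 : fderiv ℝ F (e.symm y) (fderiv ℝ e.symm y (EuclideanSpace.single i 1)) i = 1 := by
    rw [← ContinuousLinearMap.comp_apply, hcomp]
    simp
  rw [clm_apply_eq_sum_single, Finset.sum_eq_single i] at h1
  · have := hF.diag_pos (e.symm y) i
    exact pos_of_mul_pos_left (by rw [h1]; exact one_pos) this.le
  · intro j _ hj
    rcases lt_or_gt_of_ne hj with hj | hj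
    · rw [hup y j i hj, zero_mul]
    · rw [hF.upper_eq_zero _ i j hj, mul_zero]
  · simp

/-- A triangular change is surjective as soon as each component is surjective in its own last
coordinate: the coordinates of a preimage are chosen one after the other. -/
lemma surjective (hF : IsTriangularChange F)
    (h : ∀ x i (t : ℝ), ∃ s : ℝ, F (x + s • EuclideanSpace.single i 1) i = t) :
    Function.Surjective F := by
  intro y
  suffices H : ∀ m : ℕ, ∃ x, ∀ k : Fin n, k.val < m → F x k = y k by
    obtain ⟨x, hx⟩ := H n
    exact ⟨x, by ext k; exact hx k k.isLt⟩
  intro m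
  induction m with
  | zero => exact ⟨0, by simp⟩
  | succ m ih =>
    obtain ⟨x, hx⟩ := ih
    by_cases hm : m < n
    · obtain ⟨s, hs⟩ := h x ⟨m, hm⟩ (y ⟨m, hm⟩)
      refine ⟨x + s • EuclideanSpace.single ⟨m, hm⟩ 1, fun k hk => ?_⟩
      rcases Nat.lt_succ_iff_lt_or_eq.1 hk with hk | hk
      · rw [← hx k hk]
        refine hF.apply_eq_of_forall_le fun l hl => ?_
        have : l ≠ ⟨m, hm⟩ := (lt_of_le_of_lt hl (Fin.lt_def.2 hk)).ne
        simp [this]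
      · obtain rfl : k = ⟨m, hm⟩ := Fin.ext hk
        exact hs
    · exact ⟨x, fun k _ => hx k (k.isLt.trans_le (not_lt.1 hm))⟩

end IsTriangularChange

end Triangular

/-! ### The Knöthe map onto a Gaussian mixture -/

lemma hasDerivAt_cdf_gaussianReal {v : ℝ≥0} (hv : v ≠ 0) (t : ℝ) :
    HasDerivAt (cdf (gaussianReal 0 v)) (gaussianPDFReal 0 v t) t := by
  have hc := continuous_gaussianPDFReal v
  have hi := integrable_gaussianPDFReal 0 v
  have h1 : ∀ t, cdf (gaussianReal 0 v) t = ∫ s in Set.Iic t, gaussianPDFReal 0 v s := fun t => by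
    rw [cdf_eq_real, measureReal_def, gaussianReal_apply_eq_integral 0 hv, ENNReal.toReal_ofReal]
    exact integral_nonneg fun x => gaussianPDFReal_nonneg _ _ _
  have h2 : (cdf (gaussianReal 0 v) : ℝ → ℝ) = fun t => (∫ s in Set.Iic 0, gaussianPDFReal 0 v s) +
      ∫ s in (0 : ℝ)..t, gaussianPDFReal 0 v s := by
    funext t
    rw [h1, ← intervalIntegral.integral_Iic_sub_Iic hi.integrableOn hi.integrableOn]
    ring
  rw [h2]
  exact (intervalIntegral.integral_hasDerivAt_right (hc.intervalIntegrable _ _)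
    (hc.stronglyMeasurableAtFilter _ _) hc.continuousAt).const_add _

lemma contDiff_cdf_gaussianReal {v : ℝ≥0} (hv : v ≠ 0) :
    ContDiff ℝ 1 (cdf (gaussianReal 0 v)) := by
  rw [contDiff_one_iff_deriv]
  refine ⟨fun t => (hasDerivAt_cdf_gaussianReal hv t).differentiableAt, ?_⟩
  rw [show deriv (cdf (gaussianReal 0 v)) = gaussianPDFReal 0 v from
    funext fun t => (hasDerivAt_cdf_gaussianReal hv t).deriv]
  exact continuous_gaussianPDFReal v

lemma strictMono_cdf_gaussianReal {v : ℝ≥0} (hv : v ≠ 0) :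
    StrictMono (cdf (gaussianReal 0 v)) :=
  strictMono_of_deriv_pos fun t => by
    rw [(hasDerivAt_cdf_gaussianReal hv t).deriv]
    exact gaussianPDFReal_pos _ _ _ hv

lemma cdf_gaussianReal_mem_Ioo {v : ℝ≥0} (hv : v ≠ 0) (t : ℝ) :
    cdf (gaussianReal 0 v) t ∈ Set.Ioo (0 : ℝ) 1 :=
  ⟨(cdf_nonneg _ (t - 1)).trans_lt (strictMono_cdf_gaussianReal hv (by linarith)),
    (strictMono_cdf_gaussianReal hv (show t < t + 1 by linarith)).trans_le (cdf_le_one _ _)⟩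

lemma exists_cdf_gaussianReal_eq {v : ℝ≥0} (hv : v ≠ 0) {u : ℝ} (hu : u ∈ Set.Ioo (0 : ℝ) 1) :
    ∃ t, cdf (gaussianReal 0 v) t = u := by
  obtain ⟨a, ha⟩ := ((tendsto_cdf_atBot (gaussianReal 0 v)).eventually_lt_const hu.1).exists
  obtain ⟨b, hb⟩ := ((tendsto_cdf_atTop (gaussianReal 0 v)).eventually_const_lt hu.2).exists
  exact mem_range_of_exists_le_of_exists_ge (contDiff_cdf_gaussianReal hv).continuous
    ⟨a, ha.le⟩ ⟨b, hb.le⟩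

/-- The Gaussian quantile function is continuously differentiable on `(0, 1)`. -/
lemma exists_quantile_gaussianReal {v : ℝ≥0} (hv : v ≠ 0) :
    ∃ q : ℝ → ℝ, (∀ t, q (cdf (gaussianReal 0 v) t) = t) ∧
      (∀ u ∈ Set.Ioo (0 : ℝ) 1, cdf (gaussianReal 0 v) (q u) = u) ∧
      ∀ u ∈ Set.Ioo (0 : ℝ) 1, ContDiffAt ℝ 1 q u := by
  have hC := contDiff_cdf_gaussianReal hv
  have hpos := fun t => (gaussianPDFReal_pos 0 v t hv).ne'
  have hopen : IsOpenMap (cdf (gaussianReal 0 v)) := isOpenMap_of_hasStrictDerivAt (fun t =>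
    hC.contDiffAt.hasStrictDerivAt' (hasDerivAt_cdf_gaussianReal hv t) one_ne_zero) hpos
  have he : IsOpenEmbedding (cdf (gaussianReal 0 v)) :=
    .of_continuous_injective_isOpenMap hC.continuous (strictMono_cdf_gaussianReal hv).injective
      hopen
  let e := he.toOpenPartialHomeomorph
  have hl : ∀ t, e.symm (cdf (gaussianReal 0 v) t) = t := fun t => e.left_inv (by simp [e])
  have ht : ∀ u ∈ Set.Ioo (0 : ℝ) 1, u ∈ e.target := fun u hu => by
    simpa [e] using exists_cdf_gaussianReal_eq hv hu
  exact ⟨e.symm, hl, fun u hu => e.right_inv (ht u hu), fun u hu =>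
    e.contDiffAt_symm_deriv (hpos (e.symm u)) (ht u hu) (hasDerivAt_cdf_gaussianReal hv _)
      hC.contDiffAt⟩

section Kernel

variable {n : ℕ} {v : ℝ≥0}

/-- The Gaussian density of the first `m` coordinates, as a function on the whole space. -/
noncomputable def partialKernel (n : ℕ) (v : ℝ≥0) (m : ℕ) (z : EuclideanSpace ℝ (Fin n)) : ℝ :=
  ∏ k with k.val < m, gaussianPDFReal 0 v (z k)

/-- The integral of `partialKernel n v (i + 1)` over the values of the `i`-th coordinate below the
given one. -/
noncomputable def partialCDFKernel (v : ℝ≥0) (i : Fin n) (z : EuclideanSpace ℝ (Fin n)) : ℝ :=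
  partialKernel n v i z * cdf (gaussianReal 0 v) (z i)

lemma contDiff_partialKernel (m : ℕ) : ContDiff ℝ 1 (partialKernel n v m) := by
  unfold partialKernel
  refine contDiff_prod fun i _ => (contDiff_gaussianPDFReal v).comp ?_
  fun_prop

lemma contDiff_partialCDFKernel (hv : v ≠ 0) (i : Fin n) :
    ContDiff ℝ 1 (partialCDFKernel v i) :=
  (contDiff_partialKernel _).mul ((contDiff_cdf_gaussianReal hv).comp (by fun_prop))

lemma partialKernel_pos (hv : v ≠ 0) (m : ℕ) (z : EuclideanSpace ℝ (Fin n)) :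
    0 < partialKernel n v m z :=
  Finset.prod_pos fun _ _ => gaussianPDFReal_pos _ _ _ hv

lemma partialKernel_zero (z : EuclideanSpace ℝ (Fin n)) : partialKernel n v 0 z = 1 := by
  simp [partialKernel]

lemma partialKernel_self (z : EuclideanSpace ℝ (Fin n)) :
    partialKernel n v n z = whiteDensity n v z := by
  simp [partialKernel, whiteDensity]

lemma partialKernel_succ (i : Fin n) (z : EuclideanSpace ℝ (Fin n)) :
    partialKernel n v (i + 1) z = partialKernel n v i z * gaussianPDFReal 0 v (z i) := by
  have h : (Finset.univ.filter fun k : Fin n => k.val < i.val + 1) =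
      insert i (Finset.univ.filter fun k : Fin n => k.val < i.val) := by
    ext k
    simp only [Finset.mem_filter, Finset.mem_univ, true_and, Finset.mem_insert, Fin.ext_iff]
    omega
  rw [partialKernel, h, Finset.prod_insert (by simp), mul_comm, partialKernel]

lemma partialKernel_add_single {m : ℕ} {j : Fin n} (hj : m ≤ j) (z : EuclideanSpace ℝ (Fin n))
    (s : ℝ) : partialKernel n v m (z + s • EuclideanSpace.single j 1) = partialKernel n v m z := by
  refine Finset.prod_congr rfl fun k hk => ?_
  have : k ≠ j := by
    rintro rfl
    simp only [Finset.mem_filter, Finset.mem_univ, true_and] at hk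
    omega
  simp [this]

lemma partialCDFKernel_add_single {i j : Fin n} (hj : i < j) (z : EuclideanSpace ℝ (Fin n))
    (s : ℝ) :
    partialCDFKernel v i (z + s • EuclideanSpace.single j 1) = partialCDFKernel v i z := by
  rw [partialCDFKernel, partialKernel_add_single (Fin.le_def.1 hj.le), partialCDFKernel]
  simp [hj.ne]

lemma fderiv_partialCDFKernel_single (hv : v ≠ 0) (i : Fin n) (z : EuclideanSpace ℝ (Fin n)) :
    fderiv ℝ (partialCDFKernel v i) z (EuclideanSpace.single i 1) =
      partialKernel n v (i + 1) z := by
  have h2 := ((contDiff_partialCDFKernel hv i).differentiable one_ne_zero z).hasFDerivAt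
    |>.hasLineDerivAt (EuclideanSpace.single i 1)
  unfold HasLineDerivAt at h2
  have h3 : (fun t : ℝ => partialCDFKernel v i (z + t • EuclideanSpace.single i (1 : ℝ))) =
      fun t => partialKernel n v i z * cdf (gaussianReal 0 v) (z i + t) := by
    funext t
    simp only [partialCDFKernel, partialKernel_add_single le_rfl]
    simp
  have h4 : HasDerivAt (fun t => partialKernel n v i z * cdf (gaussianReal 0 v) (z i + t))
      (partialKernel n v (i + 1) z) 0 := by
    rw [partialKernel_succ]
    refine HasDerivAt.const_mul _ ?_
    have h := hasDerivAt_cdf_gaussianReal hv (z i + 0)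
    simpa using h.comp_const_add (z i) 0
  rw [h3] at h2
  exact h2.unique h4

end Kernel

section Knothe

variable {n : ℕ} {μ : Measure (EuclideanSpace ℝ (Fin n))} {v : ℝ≥0}
  {R : ℝ}

/-- The joint density of the first `m` coordinates under the law with density
`gaussianMixture μ v`. -/
noncomputable def marginalDensity (μ : Measure (EuclideanSpace ℝ (Fin n))) (v : ℝ≥0) (m : ℕ)
    (y : EuclideanSpace ℝ (Fin n)) : ℝ :=
  ∫ x, partialKernel n v m (y - x) ∂μ

/-- The conditional distribution function of the `i`-th coordinate given the previous ones, under
the law with density `gaussianMixture μ v`. -/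
noncomputable def conditionalCDF (μ : Measure (EuclideanSpace ℝ (Fin n))) (v : ℝ≥0) (i : Fin n)
    (y : EuclideanSpace ℝ (Fin n)) : ℝ :=
  (∫ x, partialCDFKernel v i (y - x) ∂μ) / marginalDensity μ v i y

lemma marginalDensity_self (y : EuclideanSpace ℝ (Fin n)) :
    marginalDensity μ v n y = gaussianMixture μ v y := by
  simp [marginalDensity, gaussianMixture, partialKernel_self]

lemma marginalDensity_add_single {m : ℕ} {j : Fin n} (hj : m ≤ j) (y : EuclideanSpace ℝ (Fin n))
    (s : ℝ) : marginalDensity μ v m (y + s • EuclideanSpace.single j 1) =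
      marginalDensity μ v m y := by
  simp only [marginalDensity, add_sub_right_comm, partialKernel_add_single hj]

lemma conditionalCDF_add_single {i j : Fin n} (hj : i < j) (y : EuclideanSpace ℝ (Fin n)) (s : ℝ) :
    conditionalCDF μ v i (y + s • EuclideanSpace.single j 1) = conditionalCDF μ v i y := by
  rw [conditionalCDF, marginalDensity_add_single (Fin.le_def.1 hj.le), conditionalCDF]
  simp only [add_sub_right_comm, partialCDFKernel_add_single hj]

variable [IsProbabilityMeasure μ]

lemma marginalDensity_pos (hv : v ≠ 0) (hμ : ∀ᵐ x ∂μ, ‖x‖ ≤ R) (m : ℕ)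
    (y : EuclideanSpace ℝ (Fin n)) : 0 < marginalDensity μ v m y := by
  have hp : ∀ x, 0 < partialKernel n v m (y - x) := fun x => partialKernel_pos hv m _
  rw [marginalDensity, integral_pos_iff_support_of_nonneg (fun x => (hp x).le)
    (integrable_sub_of_continuous hμ (contDiff_partialKernel m).continuous y)]
  rw [Function.support_eq_univ (fun x => (hp x).ne')]
  simp

lemma marginalDensity_zero (y : EuclideanSpace ℝ (Fin n)) : marginalDensity μ v 0 y = 1 := by
  simp [marginalDensity, partialKernel_zero]

lemma contDiff_conditionalCDF (hv : v ≠ 0) (hμ : ∀ᵐ x ∂μ, ‖x‖ ≤ R) (i : Fin n) :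
    ContDiff ℝ 1 (conditionalCDF μ v i) :=
  (contDiff_integral_sub hμ (contDiff_partialCDFKernel hv i)).div
    (contDiff_integral_sub hμ (contDiff_partialKernel _))
    fun y => (marginalDensity_pos hv hμ i y).ne'

/-- The conditional density of the `i`-th coordinate is a ratio of marginal densities. -/
lemma hasDerivAt_conditionalCDF (hv : v ≠ 0) (hμ : ∀ᵐ x ∂μ, ‖x‖ ≤ R) (i : Fin n)
    (y : EuclideanSpace ℝ (Fin n)) :
    HasDerivAt (fun t : ℝ => conditionalCDF μ v i (y + t • EuclideanSpace.single i 1))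
      (marginalDensity μ v (i + 1) y / marginalDensity μ v i y) 0 := by
  have hL := contDiff_partialCDFKernel hv i
  have h2 := (hasFDerivAt_integral_sub hμ hL y).hasLineDerivAt (EuclideanSpace.single i 1)
  rw [HasLineDerivAt, ContinuousLinearMap.integral_apply
    (integrable_sub_of_continuous hμ (hL.continuous_fderiv one_ne_zero) y)] at h2
  simp only [fderiv_partialCDFKernel_single hv] at h2
  simp only [conditionalCDF, marginalDensity_add_single le_rfl]
  exact h2.div_const _

/-- As a conditional distribution function is an average of translates by at most `R` of the
Gaussian one, it inherits the limits of the latter at `±∞`. -/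
lemma cdf_le_conditionalCDF (hv : v ≠ 0) (hμ : ∀ᵐ x ∂μ, ‖x‖ ≤ R) (i : Fin n)
    (y : EuclideanSpace ℝ (Fin n)) :
    cdf (gaussianReal 0 v) (y i - R) ≤ conditionalCDF μ v i y := by
  rw [conditionalCDF, le_div_iff₀ (marginalDensity_pos hv hμ i y), marginalDensity,
    ← integral_const_mul]
  refine integral_mono_ae ((integrable_sub_of_continuous hμ
    (contDiff_partialKernel _).continuous y).const_mul _) (integrable_sub_of_continuous hμ
      (contDiff_partialCDFKernel hv i).continuous y) ?_
  filter_upwards [hμ] with x hx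
  rw [partialCDFKernel, mul_comm]
  refine mul_le_mul_of_nonneg_left (monotone_cdf _ ?_) (partialKernel_pos hv _ _).le
  have := (abs_le.1 ((PiLp.norm_apply_le x i).trans hx)).2
  simp only [PiLp.sub_apply]
  linarith

lemma conditionalCDF_le_cdf (hv : v ≠ 0) (hμ : ∀ᵐ x ∂μ, ‖x‖ ≤ R) (i : Fin n)
    (y : EuclideanSpace ℝ (Fin n)) :
    conditionalCDF μ v i y ≤ cdf (gaussianReal 0 v) (y i + R) := by
  rw [conditionalCDF, div_le_iff₀ (marginalDensity_pos hv hμ i y), marginalDensity,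
    ← integral_const_mul]
  refine integral_mono_ae (integrable_sub_of_continuous hμ
      (contDiff_partialCDFKernel hv i).continuous y) ((integrable_sub_of_continuous hμ
    (contDiff_partialKernel _).continuous y).const_mul _) ?_
  filter_upwards [hμ] with x hx
  rw [partialCDFKernel, mul_comm]
  refine mul_le_mul_of_nonneg_right (monotone_cdf _ ?_) (partialKernel_pos hv _ _).le
  have := (abs_le.1 ((PiLp.norm_apply_le x i).trans hx)).1
  simp only [PiLp.sub_apply]
  linarith

lemma conditionalCDF_mem_Ioo (hv : v ≠ 0) (hμ : ∀ᵐ x ∂μ, ‖x‖ ≤ R) (i : Fin n)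
    (y : EuclideanSpace ℝ (Fin n)) : conditionalCDF μ v i y ∈ Set.Ioo (0 : ℝ) 1 :=
  ⟨(cdf_gaussianReal_mem_Ioo hv _).1.trans_le (cdf_le_conditionalCDF hv hμ i y),
    (conditionalCDF_le_cdf hv hμ i y).trans_lt (cdf_gaussianReal_mem_Ioo hv _).2⟩

lemma exists_conditionalCDF_eq (hv : v ≠ 0) (hμ : ∀ᵐ x ∂μ, ‖x‖ ≤ R) (i : Fin n)
    (y : EuclideanSpace ℝ (Fin n)) {u : ℝ} (hu : u ∈ Set.Ioo (0 : ℝ) 1) :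
    ∃ s : ℝ, conditionalCDF μ v i (y + s • EuclideanSpace.single i 1) = u := by
  obtain ⟨a, rfl⟩ := exists_cdf_gaussianReal_eq hv hu
  have hc : Continuous fun s : ℝ => conditionalCDF μ v i (y + s • EuclideanSpace.single i 1) :=
    (contDiff_conditionalCDF hv hμ i).continuous.comp (by fun_prop)
  refine mem_range_of_exists_le_of_exists_ge hc ⟨a - y i - R, ?_⟩ ⟨a - y i + R, ?_⟩
  · refine (conditionalCDF_le_cdf hv hμ i _).trans_eq (congrArg _ ?_)
    simp only [PiLp.add_apply, PiLp.smul_apply, PiLp.single_apply, if_true, smul_eq_mul]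
    ring
  · refine Eq.trans_le (congrArg _ ?_) (cdf_le_conditionalCDF hv hμ i _)
    simp only [PiLp.add_apply, PiLp.smul_apply, PiLp.single_apply, if_true, smul_eq_mul]
    ring

/-- The Knöthe map: a triangular change `F` transporting a white Gaussian vector to the law with
density `gaussianMixture μ v`. Its inverse `G` maps `y` to the vector of Gaussian quantiles of the
successive conditional distribution functions. -/
theorem exists_knothe_map (hv : v ≠ 0) (hμ : ∀ᵐ x ∂μ, ‖x‖ ≤ R) {Q : ℝ≥0} (hQ : Q ≠ 0) :
    ∃ F G : EuclideanSpace ℝ (Fin n) → EuclideanSpace ℝ (Fin n),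
      IsTriangularChange F ∧ Measurable G ∧ (∀ y, F (G y) = y) ∧
      (volume.withDensity (fun y => ENNReal.ofReal (gaussianMixture μ v y))).map G =
        whiteGaussian n Q := by
  obtain ⟨q, hq1, hq2, hq3⟩ := exists_quantile_gaussianReal hQ
  let G : EuclideanSpace ℝ (Fin n) → EuclideanSpace ℝ (Fin n) := fun y =>
    WithLp.toLp 2 fun i => q (conditionalCDF μ v i y)
  have hGi : ∀ y i, G y i = q (conditionalCDF μ v i y) := fun _ _ => rfl
  have hcdf : ∀ y i, cdf (gaussianReal 0 Q) (G y i) = conditionalCDF μ v i y := fun y i =>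
    hq2 _ (conditionalCDF_mem_Ioo hv hμ i y)
  have hGC : ContDiff ℝ 1 G := by
    rw [contDiff_euclidean]
    intro i
    rw [contDiff_iff_contDiffAt]
    exact fun y => (hq3 _ (conditionalCDF_mem_Ioo hv hμ i y)).comp y
      (contDiff_conditionalCDF hv hμ i).contDiffAt
  have hline := fun y i j =>
    hasDerivAt_line_apply (hGC.differentiable one_ne_zero y) (EuclideanSpace.single j 1) i
  -- obtained by differentiating `hcdf` in the `i`-th coordinate
  have hdiag : ∀ y i, gaussianPDFReal 0 Q (G y i) *
      fderiv ℝ G y (EuclideanSpace.single i 1) i =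
        marginalDensity μ v (i + 1) y / marginalDensity μ v i y := fun y i => by
    have h1 := (hasDerivAt_cdf_gaussianReal hQ
      (G (y + (0 : ℝ) • EuclideanSpace.single i 1) i)).comp (0 : ℝ) (hline y i i)
    rw [zero_smul, add_zero] at h1
    refine h1.unique ?_
    refine (hasDerivAt_conditionalCDF hv hμ i y).congr_of_eventuallyEq (Eventually.of_forall ?_)
    exact fun t => hcdf _ _
  have hG : IsTriangularChange G := by
    refine ⟨hGC, fun y i j hij => ?_, fun y i => ?_⟩
    · have h := hline y i j
      simp only [hGi, conditionalCDF_add_single hij] at h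
      exact h.unique (hasDerivAt_const _ _)
    · have h := hdiag y i
      have h1 := div_pos (marginalDensity_pos hv hμ (i + 1) y) (marginalDensity_pos hv hμ i y)
      rw [← h] at h1
      exact pos_of_mul_pos_right h1 (gaussianPDFReal_nonneg _ _ _)
  have hsurj : Function.Surjective G := hG.surjective fun x i t => by
    obtain ⟨s, hs⟩ := exists_conditionalCDF_eq hv hμ i x (cdf_gaussianReal_mem_Ioo hQ t)
    exact ⟨s, by rw [hGi, hs, hq1]⟩
  have hdens : ∀ y, |(fderiv ℝ G y).det| * whiteDensity n Q (G y) = gaussianMixture μ v y := by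
    intro y
    rw [abs_of_pos (hG.det_fderiv_pos y), hG.det_fderiv, whiteDensity, ← Finset.prod_mul_distrib]
    simp_rw [mul_comm (fderiv ℝ G y _ _), hdiag]
    -- the product telescopes from `marginalDensity μ v 0 = 1` to the full density
    rw [Fin.prod_univ_eq_prod_range
      (fun m => marginalDensity μ v (m + 1) y / marginalDensity μ v m y), ← marginalDensity_self]
    exact Finset.prod_range_induction _ _ (marginalDensity_zero y) _ fun m _ =>
      (mul_div_cancel₀ _ (marginalDensity_pos hv hμ m y).ne').symm
  obtain ⟨F, hF, hFG, -⟩ := hG.exists_inverse hsurj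
  have hGm : Measurable G := hGC.continuous.measurable
  refine ⟨F, G, hF, hGm, hFG, ?_⟩
  ext s hs
  rw [Measure.map_apply hGm hs, withDensity_apply _ (hGm hs), whiteGaussian_eq_withDensity n hQ,
    withDensity_apply _ hs]
  nth_rewrite 2 [← Set.image_preimage_eq s hsurj]
  rw [lintegral_image_eq_lintegral_abs_det_fderiv_mul volume (hGm hs)
    (fun y _ => (hG.differentiable y).hasFDerivAt.hasFDerivWithinAt) hG.injective.injOn]
  refine lintegral_congr fun y => ?_
  rw [← ENNReal.ofReal_mul (abs_nonneg _), hdens]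

end Knothe

/-! ### Stein's identity for monotone functions -/

section Stein

variable {v : ℝ≥0}

lemma hasDerivAt_neg_mul_gaussianPDFReal (hv : v ≠ 0) (x : ℝ) :
    HasDerivAt (fun x => -(v * gaussianPDFReal 0 v x)) (x * gaussianPDFReal 0 v x) x := by
  have hv' : (v : ℝ) ≠ 0 := by exact_mod_cast hv
  have h1 : HasDerivAt (fun x : ℝ => -x ^ 2 / (2 * v)) (-x / v) x := by
    refine (((hasDerivAt_pow 2 x).fun_neg).div_const (2 * (v : ℝ))).congr_deriv ?_
    norm_num
    field_simp
  have h2 := ((h1.exp.const_mul ((√(2 * Real.pi * v))⁻¹)).const_mul (v : ℝ)).fun_neg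
  simp only [gaussianPDFReal, sub_zero]
  refine h2.congr_deriv ?_
  field_simp

lemma integrable_mul_gaussianPDFReal (hv : v ≠ 0) :
    Integrable (fun x => x * gaussianPDFReal 0 v x) := by
  have h : Integrable (fun x : ℝ => x) (gaussianReal 0 v) :=
    (memLp_id_gaussianReal (μ := 0) (v := v) 1).integrable le_rfl
  rw [gaussianReal_of_var_ne_zero 0 hv, integrable_withDensity_iff
    (measurable_gaussianPDF 0 v) (ae_of_all _ fun _ => gaussianPDF_lt_top)] at h
  simpa [toReal_gaussianPDF] using h

lemma tendsto_gaussianPDFReal_atTop (hv : v ≠ 0) :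
    Tendsto (gaussianPDFReal 0 v) atTop (𝓝 0) := by
  have hv' : (0 : ℝ) < v := by positivity
  unfold gaussianPDFReal
  simp only [sub_zero, neg_div]
  rw [← mul_zero ((√(2 * Real.pi * v))⁻¹)]
  refine Tendsto.const_mul _ (Real.tendsto_exp_atBot.comp ?_)
  exact tendsto_neg_atTop_atBot.comp
    ((tendsto_pow_atTop two_ne_zero).atTop_div_const (by positivity))

lemma setLIntegral_Ici_mul_gaussianPDFReal (hv : v ≠ 0) {t : ℝ} (ht : 0 < t) :
    ∫⁻ x in Set.Ici t, ENNReal.ofReal (x * gaussianPDFReal 0 v x) =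
      ENNReal.ofReal (v * gaussianPDFReal 0 v t) := by
  rw [setLIntegral_congr Ioi_ae_eq_Ici.symm, ← ofReal_integral_eq_lintegral_ofReal
    (integrable_mul_gaussianPDFReal hv).integrableOn]
  · rw [integral_Ioi_of_hasDerivAt_of_tendsto' (m := 0)
      (fun x _ => hasDerivAt_neg_mul_gaussianPDFReal hv x)
      (integrable_mul_gaussianPDFReal hv).integrableOn]
    · simp
    · simpa using ((tendsto_gaussianPDFReal_atTop hv).const_mul (v : ℝ)).neg
  · filter_upwards [self_mem_ae_restrict measurableSet_Ioi] with x hx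
    exact mul_nonneg (ht.trans hx).le (gaussianPDFReal_nonneg _ _ _)

/-- Stein's identity for a monotone function, on the positive half-line. All integrands are
nonnegative, so that Tonelli's theorem applies without any integrability assumption. -/
lemma setLIntegral_Ioi_deriv_mul_gaussianPDFReal (hv : v ≠ 0) {g : ℝ → ℝ} (hg : ContDiff ℝ 1 g)
    (hg' : ∀ t, 0 ≤ deriv g t) :
    ∫⁻ t in Set.Ioi 0, ENNReal.ofReal (v * gaussianPDFReal 0 v t * deriv g t) =
      ∫⁻ x in Set.Ioi 0, ENNReal.ofReal (x * (g x - g 0) * gaussianPDFReal 0 v x) := by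
  have hd : Continuous (deriv g) := hg.continuous_deriv_one
  have hψ := continuous_gaussianPDFReal v
  have hψ0 := gaussianPDFReal_nonneg 0 v
  let k : ℝ → ℝ → ℝ≥0∞ := fun t x => (Set.Ici t).indicator
    (fun x => ENNReal.ofReal (deriv g t) * ENNReal.ofReal (x * gaussianPDFReal 0 v x)) x
  have hk : Measurable (Function.uncurry k) := by
    have h1 : Function.uncurry k = {z : ℝ × ℝ | z.1 ≤ z.2}.indicator (fun z =>
        ENNReal.ofReal (deriv g z.1) * ENNReal.ofReal (z.2 * gaussianPDFReal 0 v z.2)) := by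
      funext z
      rfl
    rw [h1]
    refine Measurable.indicator ?_ (measurableSet_le measurable_fst measurable_snd)
    exact (by fun_prop : Continuous fun z : ℝ × ℝ => deriv g z.1).measurable.ennreal_ofReal.mul
      (by fun_prop : Continuous fun z : ℝ × ℝ =>
        z.2 * gaussianPDFReal 0 v z.2).measurable.ennreal_ofReal
  calc ∫⁻ t in Set.Ioi 0, ENNReal.ofReal (v * gaussianPDFReal 0 v t * deriv g t)
      = ∫⁻ t in Set.Ioi 0, ∫⁻ x in Set.Ioi 0, k t x := by
        refine setLIntegral_congr_fun measurableSet_Ioi fun t ht => ?_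
        rw [lintegral_indicator measurableSet_Ici, Measure.restrict_restrict measurableSet_Ici,
          Set.inter_eq_left.2 (Set.Ici_subset_Ioi.2 ht),
          lintegral_const_mul _ (by fun_prop), setLIntegral_Ici_mul_gaussianPDFReal hv ht,
          ← ENNReal.ofReal_mul (hg' t), mul_comm]
    _ = ∫⁻ x in Set.Ioi 0, ∫⁻ t in Set.Ioi 0, k t x := lintegral_lintegral_swap hk.aemeasurable
    _ = _ := by
        refine setLIntegral_congr_fun measurableSet_Ioi fun x hx => ?_
        have hx0 : (0 : ℝ) < x := hx
        have h1 : ∀ t, k t x = (Set.Iic x).indicator (fun t => ENNReal.ofReal (deriv g t) *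
            ENNReal.ofReal (x * gaussianPDFReal 0 v x)) t := fun t => by
          simp [k, Set.indicator]
        simp only [h1]
        rw [lintegral_indicator measurableSet_Iic, Measure.restrict_restrict measurableSet_Iic,
          Set.inter_comm, Set.Ioi_inter_Iic, lintegral_mul_const _ (by fun_prop),
          ← ofReal_integral_eq_lintegral_ofReal (hd.integrableOn_Ioc) (ae_of_all _ hg'),
          ← intervalIntegral.integral_of_le hx0.le, intervalIntegral.integral_deriv_eq_sub
            (fun y _ => hg.differentiable one_ne_zero y) (hd.intervalIntegrable _ _),
          ← ENNReal.ofReal_mul' (mul_nonneg hx0.le (hψ0 x))]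
        congr 1
        ring

lemma lintegral_deriv_mul_gaussianPDFReal (hv : v ≠ 0) {g : ℝ → ℝ} (hg : ContDiff ℝ 1 g)
    (hg' : ∀ t, 0 ≤ deriv g t) :
    ∫⁻ t, ENNReal.ofReal (v * gaussianPDFReal 0 v t * deriv g t) =
      ∫⁻ x, ENNReal.ofReal (x * (g x - g 0) * gaussianPDFReal 0 v x) := by
  have hsplit : ∀ f : ℝ → ℝ≥0∞, ∫⁻ x, f x =
      (∫⁻ x in Set.Ioi 0, f x) + ∫⁻ x in Set.Ioi 0, f (-x) := fun f => by
    rw [← lintegral_add_compl f measurableSet_Ioi (A := Set.Ioi (0 : ℝ)), Set.compl_Ioi,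
      setLIntegral_congr Iio_ae_eq_Iic.symm]
    congr 1
    have h := (Measure.measurePreserving_neg (volume : Measure ℝ)).setLIntegral_comp_preimage_emb
      (MeasurableEquiv.neg ℝ).measurableEmbedding f (Set.Iio 0)
    rw [← h]
    simp
  have hneg := setLIntegral_Ioi_deriv_mul_gaussianPDFReal hv (g := fun x => -g (-x))
    (by fun_prop) (fun t => by simpa [deriv_comp_neg] using hg' (-t))
  have hψ : ∀ x, gaussianPDFReal 0 v (-x) = gaussianPDFReal 0 v x := fun x => by
    simp [gaussianPDFReal]
  rw [hsplit, hsplit, setLIntegral_Ioi_deriv_mul_gaussianPDFReal hv hg hg']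
  congr 1
  simp only [deriv.fun_neg, deriv_comp_neg, neg_neg, neg_zero] at hneg
  simp only [hψ]
  rw [hneg]
  refine lintegral_congr fun x => ?_
  congr 1
  ring

/-- Stein's identity `v E[g'(T)] = E[T g(T)]` for a monotone function of a Gaussian variable. -/
lemma stein_identity (hv : v ≠ 0) {g : ℝ → ℝ} (hg : ContDiff ℝ 1 g) (hg' : ∀ t, 0 ≤ deriv g t)
    (hint : Integrable (fun t => t * g t) (gaussianReal 0 v)) :
    0 ≤ ∫ t, t * g t ∂(gaussianReal 0 v) ∧
    ∫⁻ t, ENNReal.ofReal (v * deriv g t) ∂(gaussianReal 0 v) =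
      ENNReal.ofReal (∫ t, t * g t ∂(gaussianReal 0 v)) := by
  have hd : Continuous (deriv g) := hg.continuous_deriv_one
  have hid : Integrable (fun t : ℝ => t) (gaussianReal 0 v) :=
    (memLp_id_gaussianReal (μ := 0) (v := v) 1).integrable le_rfl
  have hmono : Monotone g := monotone_of_deriv_nonneg (hg.differentiable one_ne_zero) hg'
  have hnn : ∀ t, 0 ≤ t * (g t - g 0) := fun t => by
    rcases le_total 0 t with h | h
    · exact mul_nonneg h (sub_nonneg.2 (hmono h))
    · exact mul_nonneg_of_nonpos_of_nonpos h (sub_nonpos.2 (hmono h))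
  -- subtracting `g 0` makes the integrand nonnegative and leaves the integral unchanged
  have heq : ∫ t, t * g t ∂(gaussianReal 0 v) = ∫ t, t * (g t - g 0) ∂(gaussianReal 0 v) := by
    simp only [mul_sub]
    rw [integral_sub hint (hid.mul_const _), integral_mul_const, integral_id_gaussianReal]
    simp
  have hint' : Integrable (fun t => t * (g t - g 0)) (gaussianReal 0 v) := by
    simp only [mul_sub]
    exact hint.sub (hid.mul_const (g 0))
  have hgc := hg.continuous
  refine ⟨heq ▸ integral_nonneg hnn, ?_⟩
  rw [heq, ofReal_integral_eq_lintegral_ofReal hint' (ae_of_all _ hnn),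
    gaussianReal_of_var_ne_zero 0 hv,
    lintegral_withDensity_eq_lintegral_mul _ (measurable_gaussianPDF 0 v) (by fun_prop),
    lintegral_withDensity_eq_lintegral_mul _ (measurable_gaussianPDF 0 v) (by fun_prop)]
  have h := lintegral_deriv_mul_gaussianPDFReal hv hg hg'
  simp only [Pi.mul_apply, gaussianPDF, ← ENNReal.ofReal_mul (gaussianPDFReal_nonneg 0 v _)]
  simp only [mul_comm (gaussianPDFReal 0 v _) (_ * (_ - _)), mul_left_comm (gaussianPDFReal 0 v _)]
  simpa only [mul_assoc] using h

lemma toLp_insertNth {m : ℕ} (i : Fin (m + 1)) (t : ℝ) (z : Fin m → ℝ) :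
    (WithLp.toLp 2 (i.insertNth t z : Fin (m + 1) → ℝ) : EuclideanSpace ℝ (Fin (m + 1))) =
      WithLp.toLp 2 (i.insertNth 0 z : Fin (m + 1) → ℝ) + t • EuclideanSpace.single i 1 := by
  ext k
  refine Fin.succAboveCases i ?_ (fun k => ?_) k
  · simp
  · simp [Fin.succAbove_ne]

lemma measurePreserving_insertNth_whiteGaussian {m : ℕ} (i : Fin (m + 1)) :
    MeasurePreserving (fun z : ℝ × (Fin m → ℝ) =>
        (WithLp.toLp 2 (i.insertNth z.1 z.2 : Fin (m + 1) → ℝ) : EuclideanSpace ℝ (Fin (m + 1))))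
      ((gaussianReal 0 v).prod (Measure.pi fun _ => gaussianReal 0 v))
      (whiteGaussian (m + 1) v) := by
  have h1 := (measurePreserving_piFinSuccAbove (fun _ : Fin (m + 1) => gaussianReal 0 v) i).symm
  have h2 : MeasurePreserving (WithLp.toLp 2 : (Fin (m + 1) → ℝ) → EuclideanSpace ℝ (Fin (m + 1)))
      (Measure.pi fun _ => gaussianReal 0 v) (whiteGaussian (m + 1) v) := ⟨by fun_prop, rfl⟩
  exact h2.comp h1

/-- Stein's identity in one coordinate of a white Gaussian vector, for a function that is monotone
in that coordinate. -/
lemma stein_identity_whiteGaussian {n : ℕ} (hv : v ≠ 0) (i : Fin n)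
    {f : EuclideanSpace ℝ (Fin n) → ℝ} (hf : ContDiff ℝ 1 f)
    (hf' : ∀ y, 0 ≤ fderiv ℝ f y (EuclideanSpace.single i 1))
    (hint : Integrable (fun y => y i * f y) (whiteGaussian n v)) :
    Integrable (fun y => fderiv ℝ f y (EuclideanSpace.single i 1)) (whiteGaussian n v) ∧
      v * ∫ y, fderiv ℝ f y (EuclideanSpace.single i 1) ∂(whiteGaussian n v) =
        ∫ y, y i * f y ∂(whiteGaussian n v) := by
  cases n with
  | zero => exact i.elim0
  | succ m =>
  have hΨ := measurePreserving_insertNth_whiteGaussian (v := v) i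
  have hf1 : Continuous (fderiv ℝ f) := hf.continuous_fderiv one_ne_zero
  have hline : ∀ z : Fin m → ℝ, (fun t : ℝ => (WithLp.toLp 2 (i.insertNth t z : Fin (m + 1) → ℝ) :
      EuclideanSpace ℝ (Fin (m + 1)))) = fun t => WithLp.toLp 2 (i.insertNth 0 z) +
        t • EuclideanSpace.single i 1 := fun z => funext fun t => toLp_insertNth i t z
  have hder : ∀ (z : Fin m → ℝ) t, HasDerivAt (fun t => f (WithLp.toLp 2 (i.insertNth t z)))
      (fderiv ℝ f (WithLp.toLp 2 (i.insertNth t z)) (EuclideanSpace.single i 1)) t := by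
    intro z t
    have h1 : HasDerivAt (fun t : ℝ => (WithLp.toLp 2 (i.insertNth t z : Fin (m + 1) → ℝ) :
        EuclideanSpace ℝ (Fin (m + 1)))) (EuclideanSpace.single i 1) t := by
      rw [hline z]
      simpa using ((hasDerivAt_id t).smul_const (EuclideanSpace.single i (1 : ℝ))).const_add
        (WithLp.toLp 2 (i.insertNth 0 z : Fin (m + 1) → ℝ))
    exact (hf.differentiable one_ne_zero _).hasFDerivAt.comp_hasDerivAt t h1
  have hC : ∀ z : Fin m → ℝ, ContDiff ℝ 1 fun t => f (WithLp.toLp 2 (i.insertNth t z)) := by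
    intro z
    refine hf.comp (g := f) ?_
    rw [hline z]
    fun_prop
  have hint2 : Integrable (fun z : ℝ × (Fin m → ℝ) =>
      (WithLp.toLp 2 (i.insertNth z.1 z.2) : EuclideanSpace ℝ (Fin (m + 1))) i *
        f (WithLp.toLp 2 (i.insertNth z.1 z.2)))
      ((gaussianReal 0 v).prod (Measure.pi fun _ => gaussianReal 0 v)) :=
    (hΨ.integrable_comp hint.aestronglyMeasurable).2 hint
  have h1 := hint2.prod_left_ae
  have hst : ∀ᵐ z ∂(Measure.pi fun _ : Fin m => gaussianReal 0 v), _ := h1.mono fun z hz =>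
    stein_identity hv (hC z) (fun t => by rw [(hder z t).deriv]; exact hf' _) (by simpa using hz)
  have hm : Measurable fun y => ENNReal.ofReal
      (v * fderiv ℝ f y (EuclideanSpace.single i 1)) := by fun_prop
  have hm2 : Measurable fun a : ℝ × (Fin m → ℝ) => ENNReal.ofReal
      (v * fderiv ℝ f (WithLp.toLp 2 (i.insertNth a.1 a.2)) (EuclideanSpace.single i 1)) :=
    hm.comp hΨ.measurable
  have hI : ∫ y, y i * f y ∂(whiteGaussian (m + 1) v) =
      ∫ z, ∫ t, t * f (WithLp.toLp 2 (i.insertNth t z)) ∂(gaussianReal 0 v)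
        ∂(Measure.pi fun _ : Fin m => gaussianReal 0 v) := by
    rw [← hΨ.map_eq, integral_map hΨ.measurable.aemeasurable
      (by rw [hΨ.map_eq]; exact hint.aestronglyMeasurable), integral_prod_symm _ hint2]
    simp
  have hI2 : Integrable (fun z => ∫ t, t * f (WithLp.toLp 2 (i.insertNth t z)) ∂(gaussianReal 0 v))
      (Measure.pi fun _ : Fin m => gaussianReal 0 v) := by
    simpa using hint2.integral_prod_right
  have hnn : ∀ᵐ z ∂(Measure.pi fun _ : Fin m => gaussianReal 0 v),
      0 ≤ ∫ t, t * f (WithLp.toLp 2 (i.insertNth t z)) ∂(gaussianReal 0 v) :=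
    hst.mono fun z hz => hz.1
  have key : ∫⁻ y, ENNReal.ofReal (v * fderiv ℝ f y (EuclideanSpace.single i 1))
      ∂(whiteGaussian (m + 1) v) =
      ENNReal.ofReal (∫ y, y i * f y ∂(whiteGaussian (m + 1) v)) := by
    rw [← hΨ.lintegral_comp hm, lintegral_prod_symm _ hm2.aemeasurable, hI,
      ofReal_integral_eq_lintegral_ofReal hI2 hnn]
    refine lintegral_congr_ae (hst.mono fun z hz => ?_)
    beta_reduce
    rw [← hz.2]
    simp only [fun t => (hder z t).deriv]
  have hfm : Continuous fun y => v * fderiv ℝ f y (EuclideanSpace.single i 1) := by fun_prop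
  have hf'' : ∀ y, 0 ≤ v * fderiv ℝ f y (EuclideanSpace.single i 1) := fun y =>
    mul_nonneg v.coe_nonneg (hf' y)
  have hint3 : Integrable (fun y => v * fderiv ℝ f y (EuclideanSpace.single i 1))
      (whiteGaussian (m + 1) v) := by
    rw [← lintegral_ofReal_ne_top_iff_integrable hfm.aestronglyMeasurable (ae_of_all _ hf''), key]
    exact ENNReal.ofReal_ne_top
  have hv' : (v : ℝ) ≠ 0 := by exact_mod_cast hv
  refine ⟨by simpa [hv'] using hint3.const_mul (v : ℝ)⁻¹, ?_⟩
  rw [← integral_const_mul, integral_eq_lintegral_of_nonneg_ae (ae_of_all _ hf'')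
    hfm.aestronglyMeasurable, key, ENNReal.toReal_ofReal]
  rw [hI]
  exact integral_nonneg_of_ae hnn

end Stein

/-! ### Entropy and triangular changes of variables -/

lemma whiteDensity_eq_gaussianMixture (n : ℕ) (v : ℝ≥0) :
    whiteDensity n v = gaussianMixture (Measure.dirac 0) v := by
  funext y
  rw [gaussianMixture, integral_dirac, sub_zero]

lemma integrable_log_whiteDensity_comp {n : ℕ} {v : ℝ≥0} (hv : v ≠ 0) {Ω : Type*}
    [MeasurableSpace Ω] {P : Measure Ω} [IsFiniteMeasure P] {U : Ω → EuclideanSpace ℝ (Fin n)}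
    (hU : AEMeasurable U P) (hint : Integrable (fun ω => ‖U ω‖ ^ 2) P) :
    Integrable (fun ω => Real.log (whiteDensity n v (U ω))) P := by
  rw [whiteDensity_eq_gaussianMixture]
  exact integrable_log_gaussianMixture_comp hv (R := 0) (by simp [ae_dirac_eq]) hU hint

lemma diffEntropy_withDensity {n : ℕ} {f : EuclideanSpace ℝ (Fin n) → ℝ} (hf : Measurable f)
    (hf0 : ∀ y, 0 ≤ f y) :
    diffEntropy (volume.withDensity fun y => ENNReal.ofReal (f y)) =
      -∫ y, Real.log (f y) ∂(volume.withDensity fun y => ENNReal.ofReal (f y)) := by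
  rw [integral_withDensity_eq_integral_toReal_smul hf.ennreal_ofReal
    (ae_of_all _ fun _ => ENNReal.ofReal_lt_top), ← integral_neg, diffEntropy]
  refine integral_congr_ae ?_
  filter_upwards [Measure.rnDeriv_withDensity volume hf.ennreal_ofReal] with y hy
  rw [hy, ENNReal.toReal_ofReal (hf0 y), Real.negMulLog, smul_eq_mul, neg_mul]

namespace IsTriangularChange

variable {n : ℕ} {F : EuclideanSpace ℝ (Fin n) → EuclideanSpace ℝ (Fin n)}

lemma fderiv_apply (hF : IsTriangularChange F) (x w : EuclideanSpace ℝ (Fin n)) (i : Fin n) :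
    fderiv ℝ (fun y => F y i) x w = fderiv ℝ F x w i := by
  have h := (EuclideanSpace.proj (𝕜 := ℝ) i).hasFDerivAt.comp x (hF.differentiable x).hasFDerivAt
  have h' : HasFDerivAt (fun y => F y i)
      ((EuclideanSpace.proj (𝕜 := ℝ) i).comp (fderiv ℝ F x)) x := h
  rw [h'.fderiv]
  rfl

/-- The change of variables formula for densities. -/
lemma density_eq_det_mul (hF : IsTriangularChange F) {f p : EuclideanSpace ℝ (Fin n) → ℝ}
    (hf : Measurable f) (hf0 : ∀ y, 0 ≤ f y) (hp : Measurable p) (hp0 : ∀ y, 0 ≤ p y)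
    (hmap : (volume.withDensity fun y => ENNReal.ofReal (f y)).map F =
      volume.withDensity fun y => ENNReal.ofReal (p y)) :
    ∀ᵐ x, f x = (fderiv ℝ F x).det * p (F x) := by
  have hFm : Measurable F := hF.contDiff.continuous.measurable
  have hder : ∀ s : Set (EuclideanSpace ℝ (Fin n)), ∀ x ∈ s,
      HasFDerivWithinAt F (fderiv ℝ F x) s x := fun s x _ =>
    (hF.differentiable x).hasFDerivAt.hasFDerivWithinAt
  have hdet : Continuous fun x => (fderiv ℝ F x).det :=
    ContinuousLinearMap.continuous_det.comp (hF.contDiff.continuous_fderiv one_ne_zero)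
  have key : (fun x => ENNReal.ofReal (f x)) =ᵐ[volume]
      fun x => ENNReal.ofReal |(fderiv ℝ F x).det| * ENNReal.ofReal (p (F x)) := by
    refine ae_eq_of_forall_setLIntegral_eq_of_sigmaFinite hf.ennreal_ofReal
      (hdet.abs.measurable.ennreal_ofReal.mul (hp.comp hFm).ennreal_ofReal) fun s hs _ => ?_
    have hFs : MeasurableSet (F '' s) :=
      measurable_image_of_fderivWithin hs (hder s) hF.injective.injOn
    rw [← lintegral_image_eq_lintegral_abs_det_fderiv_mul volume hs (hder s) hF.injective.injOn
      (fun y => ENNReal.ofReal (p y)), ← withDensity_apply _ hFs, ← hmap,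
      Measure.map_apply hFm hFs, hF.injective.preimage_image, withDensity_apply _ hs]
  filter_upwards [key] with x hx
  rw [← ENNReal.ofReal_mul (abs_nonneg _), abs_of_pos (hF.det_fderiv_pos x)] at hx
  exact (ENNReal.ofReal_eq_ofReal_iff (hf0 x)
    (mul_nonneg (hF.det_fderiv_pos x).le (hp0 _))).1 hx

/-- If the triangular change `F` transports a white Gaussian vector `T` to a vector of density `p`,
then `E[F(T) · T]` is bounded below by the entropies. The entropies differ by
`E[log det F'(T)] = ∑ E[log ∂ᵢFᵢ(T)]`, which is at most `∑ E[∂ᵢFᵢ(T)] - n`, and `Q E[∂ᵢFᵢ(T)]` is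
`E[Tᵢ Fᵢ(T)]` by Stein's identity. -/
lemma entropy_le_integral_inner (hF : IsTriangularChange F) {Q : ℝ≥0} (hQ : Q ≠ 0)
    {p : EuclideanSpace ℝ (Fin n) → ℝ} (hp : Measurable p) (hp0 : ∀ y, 0 < p y)
    (hmap : (whiteGaussian n Q).map F = volume.withDensity fun y => ENNReal.ofReal (p y))
    (hint : Integrable (fun y => ‖F y‖ ^ 2) (whiteGaussian n Q))
    (hlog : Integrable (fun y => Real.log (p (F y))) (whiteGaussian n Q)) :
    Q * (∫ y, Real.log (whiteDensity n Q y) ∂(whiteGaussian n Q) -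
      ∫ y, Real.log (p (F y)) ∂(whiteGaussian n Q) + n) ≤
      ∫ y, inner ℝ (F y) y ∂(whiteGaussian n Q) := by
  have hFc := hF.contDiff.continuous
  have hlog' : Integrable (fun y => Real.log (whiteDensity n Q y)) (whiteGaussian n Q) :=
    integrable_log_whiteDensity_comp hQ aemeasurable_id (integrable_norm_sq_whiteGaussian n Q)
  have hmem : ∀ i, MemLp (fun y => F y i) 2 (whiteGaussian n Q) := fun i => by
    rw [memLp_two_iff_integrable_sq (by fun_prop)]
    refine hint.mono' (by fun_prop) (ae_of_all _ fun y => ?_)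
    rw [Real.norm_eq_abs, abs_of_nonneg (sq_nonneg _), ← sq_abs]
    exact pow_le_pow_left₀ (abs_nonneg _) (PiLp.norm_apply_le (F y) i) 2
  have hmem' : ∀ i, MemLp (fun y : EuclideanSpace ℝ (Fin n) => y i) 2 (whiteGaussian n Q) :=
    fun i => by
      rw [memLp_two_iff_integrable_sq (by fun_prop)]
      exact integrable_comp_apply_whiteGaussian i (by fun_prop) (integrable_sq_gaussianReal Q)
  have hprod : ∀ i, Integrable (fun y => y i * F y i) (whiteGaussian n Q) := fun i =>
    (hmem' i).integrable_mul (hmem i)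
  have hst := fun i => stein_identity_whiteGaussian hQ i (f := fun y => F y i)
    (contDiff_euclidean.1 hF.contDiff i)
    (fun y => by rw [hF.fderiv_apply]; exact (hF.diag_pos y i).le) (hprod i)
  simp only [hF.fderiv_apply] at hst
  have hinner : ∫ y, inner ℝ (F y) y ∂(whiteGaussian n Q) =
      Q * ∫ y, ∑ i, fderiv ℝ F y (EuclideanSpace.single i 1) i ∂(whiteGaussian n Q) := by
    rw [integral_finsetSum _ fun i _ => (hst i).1, Finset.mul_sum]
    simp only [(hst _).2]
    rw [← integral_finsetSum _ fun i _ => hprod i]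
    simp [PiLp.inner_apply]
  have hae : ∀ᵐ y ∂(whiteGaussian n Q), Real.log (whiteDensity n Q y) - Real.log (p (F y)) + n ≤
      ∑ i, fderiv ℝ F y (EuclideanSpace.single i 1) i := by
    have h := hF.density_eq_det_mul (continuous_whiteDensity n Q).measurable
      (fun y => (whiteDensity_pos n hQ y).le) hp (fun y => (hp0 y).le)
      (by rw [← whiteGaussian_eq_withDensity n hQ, hmap])
    have hac : whiteGaussian n Q ≪ volume := by
      rw [whiteGaussian_eq_withDensity n hQ]
      exact withDensity_absolutelyContinuous _ _
    filter_upwards [hac.ae_le h] with y hy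
    rw [hy, Real.log_mul (hF.det_fderiv_pos y).ne' (hp0 _).ne', hF.det_fderiv,
      Real.log_prod fun i _ => (hF.diag_pos y i).ne', add_sub_cancel_right,
      ← le_sub_iff_add_le]
    calc ∑ i, Real.log (fderiv ℝ F y (EuclideanSpace.single i 1) i)
        ≤ ∑ i, (fderiv ℝ F y (EuclideanSpace.single i 1) i - 1) :=
          Finset.sum_le_sum fun i _ => Real.log_le_sub_one_of_pos (hF.diag_pos y i)
      _ = _ := by simp
  rw [hinner, ← integral_sub hlog' hlog]
  refine mul_le_mul_of_nonneg_left ?_ Q.coe_nonneg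
  have h1 := integral_mono_ae ((hlog'.sub hlog).add (integrable_const (n : ℝ)))
    (integrable_finsetSum _ fun i _ => (hst i).1) hae
  refine Eq.trans_le ?_ h1
  rw [integral_add' (hlog'.sub hlog) (integrable_const _)]
  simp

end IsTriangularChange

/-! ### Mutual information and entropy -/

lemma diffEntropy_map_eq {n : ℕ} {Ω : Type*} [MeasurableSpace Ω] {P : Measure Ω}
    {U : Ω → EuclideanSpace ℝ (Fin n)}
    (hU : Measurable U) {f : EuclideanSpace ℝ (Fin n) → ℝ} (hf : Measurable f) (hf0 : ∀ y, 0 ≤ f y)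
    (hlaw : P.map U = volume.withDensity fun y => ENNReal.ofReal (f y)) :
    diffEntropy (P.map U) = -∫ ω, Real.log (f (U ω)) ∂P := by
  rw [hlaw, diffEntropy_withDensity hf hf0, ← hlaw,
    integral_map hU.aemeasurable hf.log.aestronglyMeasurable]

section MutualInformation

variable {n : ℕ} {Ω : Type*} [MeasurableSpace Ω] {P : Measure Ω} [IsProbabilityMeasure P]
  {X Y : Ω → EuclideanSpace ℝ (Fin n)} {p r : EuclideanSpace ℝ (Fin n) → ℝ}

/-- The joint law of `X` and `X + Y` when `Y` is independent of `X` and has density `p`. -/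
lemma map_prodMk_add_eq_withDensity (hX : Measurable X) (hY : Measurable Y)
    (hXY : IndepFun X Y P) (hp : Measurable p)
    (hYlaw : P.map Y = volume.withDensity fun y => ENNReal.ofReal (p y)) :
    P.map (fun ω => (X ω, X ω + Y ω)) =
      ((P.map X).prod volume).withDensity fun z => ENNReal.ofReal (p (z.2 - z.1)) := by
  have : IsProbabilityMeasure (P.map X) := Measure.isProbabilityMeasure_map hX.aemeasurable
  have hmp := measurePreserving_prod_add (P.map X)
    (volume : Measure (EuclideanSpace ℝ (Fin n)))
  have hmap : P.map (fun ω => (X ω, X ω + Y ω)) =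
      ((P.map X).prod (P.map Y)).map (fun z => (z.1, z.1 + z.2)) := by
    rw [← (indepFun_iff_map_prod_eq_prod_map_map hX.aemeasurable hY.aemeasurable).1 hXY,
      Measure.map_map (by fun_prop) (by fun_prop)]
    rfl
  ext s hs
  have hpm : Measurable fun z : EuclideanSpace ℝ (Fin n) × EuclideanSpace ℝ (Fin n) =>
    ENNReal.ofReal (p (z.2 - z.1)) := (hp.comp (by fun_prop)).ennreal_ofReal
  rw [hmap, hYlaw, prod_withDensity_right hp.ennreal_ofReal, Measure.map_apply hmp.measurable hs,
    withDensity_apply _ (hmp.measurable hs), withDensity_apply _ hs,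
    ← hmp.setLIntegral_comp_preimage hs hpm]
  simp

/-- `I(X; X + Y) = h(X + Y) - h(Y)` for `Y` independent of `X`, in the presence of densities. -/
lemma mutualInfo_add_eq (hX : Measurable X) (hY : Measurable Y) (hXY : IndepFun X Y P)
    (hp : Measurable p) (hp0 : ∀ y, 0 < p y)
    (hYlaw : P.map Y = volume.withDensity fun y => ENNReal.ofReal (p y))
    (hr : Measurable r) (hr0 : ∀ y, 0 < r y)
    (hSlaw : P.map (fun ω => X ω + Y ω) = volume.withDensity fun y => ENNReal.ofReal (r y))
    (hpint : Integrable (fun ω => Real.log (p (Y ω))) P)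
    (hrint : Integrable (fun ω => Real.log (r (X ω + Y ω))) P) :
    mutualInfo P X (fun ω => X ω + Y ω) ≠ ∞ ∧
    (mutualInfo P X (fun ω => X ω + Y ω)).toReal =
      diffEntropy (P.map fun ω => X ω + Y ω) - diffEntropy (P.map Y) := by
  have hS : Measurable fun ω => X ω + Y ω := hX.add hY
  have hXS : Measurable fun ω => (X ω, X ω + Y ω) := hX.prodMk hS
  have : IsProbabilityMeasure (P.map X) := Measure.isProbabilityMeasure_map hX.aemeasurable
  have : IsProbabilityMeasure (P.map fun ω => X ω + Y ω) :=
    Measure.isProbabilityMeasure_map hS.aemeasurable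
  have : IsProbabilityMeasure (P.map fun ω => (X ω, X ω + Y ω)) :=
    Measure.isProbabilityMeasure_map hXS.aemeasurable
  set J := P.map fun ω => (X ω, X ω + Y ω) with hJ
  set ν := (P.map X).prod (P.map fun ω => X ω + Y ω) with hν
  have hf : Measurable fun z : EuclideanSpace ℝ (Fin n) × EuclideanSpace ℝ (Fin n) =>
    p (z.2 - z.1) / r z.2 := (hp.comp (by fun_prop)).div (hr.comp measurable_snd)
  -- the density of the joint law with respect to the product of the marginals is
  -- `p(s - x) / r(s)` at `(x, s)`
  have hJν : J = ν.withDensity fun z => ENNReal.ofReal (p (z.2 - z.1) / r z.2) := by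
    have hr' : Measurable fun z : EuclideanSpace ℝ (Fin n) × EuclideanSpace ℝ (Fin n) =>
      ENNReal.ofReal (r z.2) := (hr.comp measurable_snd).ennreal_ofReal
    rw [hJ, map_prodMk_add_eq_withDensity hX hY hXY hp hYlaw, hν, hSlaw,
      prod_withDensity_right hr.ennreal_ofReal, ← withDensity_mul _
        hr' hf.ennreal_ofReal]
    congr 1
    funext z
    rw [Pi.mul_apply, ← ENNReal.ofReal_mul (hr0 _).le,
      mul_div_cancel₀ _ (hr0 _).ne']
  have hac : J ≪ ν := hJν ▸ withDensity_absolutelyContinuous _ _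
  have hllr : llr J ν =ᵐ[J] fun z => Real.log (p (z.2 - z.1) / r z.2) := by
    refine hac.ae_le ?_
    have h := Measure.rnDeriv_withDensity ν hf.ennreal_ofReal
    rw [← hJν] at h
    filter_upwards [h] with z hz
    rw [llr, hz, ENNReal.toReal_ofReal (div_pos (hp0 _) (hr0 _)).le]
  have hcomp : (fun ω => Real.log (p (X ω + Y ω - X ω) / r (X ω + Y ω))) =
      fun ω => Real.log (p (Y ω)) - Real.log (r (X ω + Y ω)) := by
    funext ω
    rw [add_sub_cancel_left, Real.log_div (hp0 _).ne' (hr0 _).ne']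
  have hint : Integrable (llr J ν) J := by
    rw [integrable_congr hllr, hJ,
      integrable_map_measure hf.log.aestronglyMeasurable hXS.aemeasurable]
    exact (hpint.sub hrint).congr (ae_of_all _ fun ω => (congrFun hcomp ω).symm)
  refine ⟨InformationTheory.klDiv_ne_top hac hint, ?_⟩
  rw [mutualInfo, InformationTheory.toReal_klDiv_of_measure_eq hac (by simp [J, ν]),
    integral_congr_ae hllr, hJ, integral_map hXS.aemeasurable hf.log.aestronglyMeasurable,
    diffEntropy_map_eq hS hr (fun y => (hr0 y).le) hSlaw,
    diffEntropy_map_eq hY hp (fun y => (hp0 y).le) hYlaw]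
  rw [hcomp, integral_sub hpint hrint]
  ring

/-- Gibbs' inequality: the cross entropy with respect to another density exceeds the entropy. -/
lemma diffEntropy_le_neg_integral_log {U : Ω → EuclideanSpace ℝ (Fin n)} (hU : Measurable U)
    {q : EuclideanSpace ℝ (Fin n) → ℝ} (hr : Measurable r) (hr0 : ∀ y, 0 < r y)
    (hlaw : P.map U = volume.withDensity fun y => ENNReal.ofReal (r y))
    (hq : Measurable q) (hq0 : ∀ y, 0 < q y)
    (hq1 : ∫⁻ y, ENNReal.ofReal (q y) = 1)
    (hrint : Integrable (fun ω => Real.log (r (U ω))) P)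
    (hqint : Integrable (fun ω => Real.log (q (U ω))) P) :
    diffEntropy (P.map U) ≤ -∫ ω, Real.log (q (U ω)) ∂P := by
  have hqr : Measurable fun y => q y / r y := hq.div hr
  have hqI : Integrable q := by
    rw [← lintegral_ofReal_ne_top_iff_integrable hq.aestronglyMeasurable
      (ae_of_all _ fun y => (hq0 y).le), hq1]
    exact ENNReal.one_ne_top
  have hq1' : ∫ y, q y = 1 := by
    rw [integral_eq_lintegral_of_nonneg_ae (ae_of_all _ fun y => (hq0 y).le)
      hq.aestronglyMeasurable, hq1, ENNReal.toReal_one]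
  have hcancel : (fun y => (ENNReal.ofReal (r y)).toReal • (q y / r y)) = q := by
    funext y
    rw [ENNReal.toReal_ofReal (hr0 y).le, smul_eq_mul, mul_div_cancel₀ _ (hr0 y).ne']
  have h1 : Integrable (fun ω => q (U ω) / r (U ω)) P := by
    have h : Integrable (fun y => q y / r y) (P.map U) := by
      rw [hlaw, integrable_withDensity_iff_integrable_smul' hr.ennreal_ofReal
        (ae_of_all _ fun _ => ENNReal.ofReal_lt_top), hcancel]
      exact hqI
    exact h.comp_measurable hU
  have h2 : ∫ ω, q (U ω) / r (U ω) ∂P = 1 := by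
    rw [← integral_map (f := fun y => q y / r y) hU.aemeasurable hqr.aestronglyMeasurable, hlaw,
      integral_withDensity_eq_integral_toReal_smul hr.ennreal_ofReal
        (ae_of_all _ fun _ => ENNReal.ofReal_lt_top), hcancel, hq1']
  rw [diffEntropy_map_eq hU hr (fun y => (hr0 y).le) hlaw, neg_le_neg_iff]
  have h3 : ∫ ω, (Real.log (q (U ω)) - Real.log (r (U ω))) ∂P ≤ ∫ ω, (q (U ω) / r (U ω) - 1) ∂P := by
    refine integral_mono (hqint.sub hrint) (h1.sub (integrable_const _)) fun ω => ?_
    simp only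
    rw [← Real.log_div (hq0 _).ne' (hr0 _).ne']
    exact Real.log_le_sub_one_of_pos (div_pos (hq0 _) (hr0 _))
  rw [integral_sub hqint hrint, integral_sub h1 (integrable_const _), h2] at h3
  simp at h3
  linarith

end MutualInformation

/-! ### The noisy channel with bounded interference -/

lemma integrable_inner_of_memLp {E Ω : Type*} [NormedAddCommGroup E] [InnerProductSpace ℝ E]
    [MeasurableSpace Ω] {P : Measure Ω} {U V : Ω → E} (hU : MemLp U 2 P) (hV : MemLp V 2 P) :
    Integrable (fun ω => inner ℝ (U ω) (V ω)) P :=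
  (hU.norm.integrable_mul hV.norm).mono' (hU.aestronglyMeasurable.inner hV.aestronglyMeasurable)
    (ae_of_all _ fun _ => norm_inner_le_norm _ _)

lemma measure_eq_of_subsingleton {α : Type*} [MeasurableSpace α] [Subsingleton α]
    (μ ν : Measure α) [IsProbabilityMeasure μ] [IsProbabilityMeasure ν] : μ = ν := by
  ext s _
  rcases Set.eq_empty_or_nonempty s with rfl | ⟨x, hx⟩
  · simp
  · rw [(Set.eq_univ_iff_forall.2 fun y => Subsingleton.elim x y ▸ hx : s = Set.univ)]
    simp

lemma lintegral_eq_one_of_map_eq {n : ℕ} {Ω : Type*} [MeasurableSpace Ω] {P : Measure Ω}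
    [IsProbabilityMeasure P] {U : Ω → EuclideanSpace ℝ (Fin n)} (hU : Measurable U)
    {f : EuclideanSpace ℝ (Fin n) → ℝ≥0∞} (hlaw : P.map U = volume.withDensity f) :
    ∫⁻ y, f y = 1 := by
  have : IsProbabilityMeasure (P.map U) := Measure.isProbabilityMeasure_map hU.aemeasurable
  rw [← setLIntegral_univ, ← withDensity_apply _ MeasurableSet.univ, ← hlaw, measure_univ]

lemma memLp_two_of_map_eq_whiteGaussian {n : ℕ} {Ω : Type*} [MeasurableSpace Ω] {P : Measure Ω}
    {v : ℝ≥0} {G : Ω → EuclideanSpace ℝ (Fin n)} (hG : Measurable G)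
    (hlaw : P.map G = whiteGaussian n v) : MemLp G 2 P := by
  rw [memLp_two_iff_integrable_sq_norm hG.aestronglyMeasurable]
  have h := integrable_norm_sq_whiteGaussian n v
  rw [← hlaw] at h
  exact h.comp_measurable hG

lemma integral_norm_sq_of_map_eq_whiteGaussian {n : ℕ} {Ω : Type*} [MeasurableSpace Ω] {P : Measure Ω}
    {v : ℝ≥0} {G : Ω → EuclideanSpace ℝ (Fin n)} (hG : Measurable G)
    (hlaw : P.map G = whiteGaussian n v) : ∫ ω, ‖G ω‖ ^ 2 ∂P = n * v := by
  rw [← integral_norm_sq_whiteGaussian, ← hlaw, integral_map hG.aemeasurable (by fun_prop)]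

lemma mul_avgPower {n : ℕ} {Ω : Type*} [MeasurableSpace Ω] {P : Measure Ω} (hn : n ≠ 0)
    (U : Ω → EuclideanSpace ℝ (Fin n)) : n * (avgPower P U : ℝ) = ∫ ω, ‖U ω‖ ^ 2 ∂P := by
  have hn' : (n : ℝ) ≠ 0 := by exact_mod_cast hn
  rw [avgPower, Real.coe_toNNReal _ (by positivity), mul_div_cancel₀ _ hn']

/-- The channel in a fixed dimension `n`: interference `X` of norm at most `√(n c)`, and a vector `W + Z`
in which `W` is a bounded zero-mean signal and `Z` is white Gaussian noise independent of `X`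
and `W`. -/
structure InterferenceModel {n : ℕ} {Ω : Type*} [MeasurableSpace Ω] (P : Measure Ω) (N : ℝ≥0)
    (c R : ℝ) (X W Z : Ω → EuclideanSpace ℝ (Fin n)) : Prop where
  measurable_interference : Measurable X
  measurable_signal : Measurable W
  measurable_noise : Measurable Z
  indep_noise : IndepFun (fun ω => (X ω, W ω)) Z P
  indep_interference : IndepFun X (fun ω => W ω + Z ω) P
  norm_interference_le : ∀ᵐ ω ∂P, ‖X ω‖ ≤ √(n * c)
  norm_signal_le : ∀ᵐ ω ∂P, ‖W ω‖ ≤ R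
  integral_signal : ∫ ω, W ω ∂P = 0
  map_noise : P.map Z = whiteGaussian n N

namespace InterferenceModel

variable {n : ℕ} {Ω : Type*} [MeasurableSpace Ω] {P : Measure Ω}
  {N : ℝ≥0} {c R : ℝ} {X W Z YG : Ω → EuclideanSpace ℝ (Fin n)}

lemma measurable_output (h : InterferenceModel P N c R X W Z) : Measurable fun ω => W ω + Z ω :=
  h.measurable_signal.add h.measurable_noise

lemma measurable_sum (h : InterferenceModel P N c R X W Z) :
    Measurable fun ω => X ω + (W ω + Z ω) :=
  h.measurable_interference.add h.measurable_output

lemma indepFun_signal_noise (h : InterferenceModel P N c R X W Z) : IndepFun W Z P :=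
  h.indep_noise.comp measurable_snd measurable_id

lemma norm_map_signal_le (h : InterferenceModel P N c R X W Z) : ∀ᵐ x ∂(P.map W), ‖x‖ ≤ R := by
  rw [ae_map_iff h.measurable_signal.aemeasurable (measurableSet_le (by fun_prop) (by fun_prop))]
  exact h.norm_signal_le

lemma norm_map_interference_le (h : InterferenceModel P N c R X W Z) :
    ∀ᵐ x ∂(P.map X), ‖x‖ ≤ √(n * c) := by
  rw [ae_map_iff h.measurable_interference.aemeasurable
    (measurableSet_le (by fun_prop) (by fun_prop))]
  exact h.norm_interference_le

lemma norm_interference_add_signal_le (h : InterferenceModel P N c R X W Z) :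
    ∀ᵐ ω ∂P, ‖X ω + W ω‖ ≤ √(n * c) + R := by
  filter_upwards [h.norm_interference_le, h.norm_signal_le] with ω h1 h2
  exact (norm_add_le _ _).trans (add_le_add h1 h2)

lemma memLp_noise (h : InterferenceModel P N c R X W Z) : MemLp Z 2 P :=
  memLp_two_of_map_eq_whiteGaussian h.measurable_noise h.map_noise

variable [IsProbabilityMeasure P]

lemma memLp_interference (h : InterferenceModel P N c R X W Z) : MemLp X 2 P :=
  MemLp.of_bound h.measurable_interference.aestronglyMeasurable _ h.norm_interference_le

lemma memLp_signal (h : InterferenceModel P N c R X W Z) : MemLp W 2 P :=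
  MemLp.of_bound h.measurable_signal.aestronglyMeasurable _ h.norm_signal_le

lemma memLp_output (h : InterferenceModel P N c R X W Z) : MemLp (fun ω => W ω + Z ω) 2 P :=
  h.memLp_signal.add h.memLp_noise

lemma memLp_sum (h : InterferenceModel P N c R X W Z) : MemLp (fun ω => X ω + (W ω + Z ω)) 2 P :=
  h.memLp_interference.add h.memLp_output

lemma integral_norm_sq_output (h : InterferenceModel P N c R X W Z) :
    ∫ ω, ‖W ω + Z ω‖ ^ 2 ∂P = ∫ ω, ‖W ω‖ ^ 2 ∂P + n * N := by
  have h0 : ∫ ω, inner ℝ (W ω) (Z ω) ∂P = 0 := by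
    have h1 := h.indepFun_signal_noise.integral_bilin (h.memLp_signal.integrable one_le_two)
      (h.memLp_noise.integrable one_le_two) (innerSL ℝ)
    simp only [h.integral_signal, map_zero, zero_apply] at h1
    exact h1
  have hW := h.memLp_signal.integrable_norm_pow two_ne_zero
  have hZ := h.memLp_noise.integrable_norm_pow two_ne_zero
  have hI := (integrable_inner_of_memLp h.memLp_signal h.memLp_noise).const_mul 2
  simp only [norm_add_sq_real]
  have hWI : Integrable (fun ω => ‖W ω‖ ^ 2 + 2 * inner ℝ (W ω) (Z ω)) P := hW.add hI
  rw [integral_add hWI hZ, integral_add hW hI, integral_const_mul, h0,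
    integral_norm_sq_of_map_eq_whiteGaussian h.measurable_noise h.map_noise]
  ring

lemma le_avgPower (h : InterferenceModel P N c R X W Z) (hn : n ≠ 0) :
    N ≤ avgPower P fun ω => W ω + Z ω := by
  have hn' : (0 : ℝ) < n := by positivity
  have h1 := mul_avgPower (P := P) hn fun ω => W ω + Z ω
  rw [h.integral_norm_sq_output] at h1
  have h2 : 0 ≤ ∫ ω, ‖W ω‖ ^ 2 ∂P := by positivity
  have h3 : (n : ℝ) * N ≤ n * (avgPower P fun ω => W ω + Z ω : ℝ) := by linarith
  exact_mod_cast le_of_mul_le_mul_left h3 hn'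

lemma avgPower_ne_zero (h : InterferenceModel P N c R X W Z) (hN : N ≠ 0) (hn : n ≠ 0) :
    (avgPower P fun ω => W ω + Z ω) ≠ 0 :=
  ((pos_iff_ne_zero.2 hN).trans_le (h.le_avgPower hn)).ne'

/-- `W + Z` has a positive density whose logarithm is integrable. -/
lemma exists_density_output (h : InterferenceModel P N c R X W Z) (hN : N ≠ 0) :
    ∃ p : EuclideanSpace ℝ (Fin n) → ℝ, Measurable p ∧ (∀ y, 0 < p y) ∧
      P.map (fun ω => W ω + Z ω) = volume.withDensity (fun y => ENNReal.ofReal (p y)) ∧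
      Integrable (fun ω => Real.log (p (W ω + Z ω))) P := by
  have : IsProbabilityMeasure (P.map W) :=
    Measure.isProbabilityMeasure_map h.measurable_signal.aemeasurable
  have hb := h.norm_map_signal_le
  exact ⟨gaussianMixture (P.map W) N, measurable_gaussianMixture hb, gaussianMixture_pos hN hb,
    map_add_eq_withDensity_gaussianMixture hN h.measurable_signal h.measurable_noise
      h.indepFun_signal_noise h.norm_signal_le h.map_noise,
    integrable_log_gaussianMixture_comp hN hb h.measurable_output.aemeasurable
      (h.memLp_output.integrable_norm_pow two_ne_zero)⟩

/-- `X + W + Z` has a positive density whose logarithm is integrable. -/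
lemma exists_density_sum (h : InterferenceModel P N c R X W Z) (hN : N ≠ 0) :
    ∃ r : EuclideanSpace ℝ (Fin n) → ℝ, Measurable r ∧ (∀ y, 0 < r y) ∧
      P.map (fun ω => X ω + (W ω + Z ω)) = volume.withDensity (fun y => ENNReal.ofReal (r y)) ∧
      Integrable (fun ω => Real.log (r (X ω + (W ω + Z ω)))) P := by
  have hm : Measurable fun ω => X ω + W ω := h.measurable_interference.add h.measurable_signal
  have : IsProbabilityMeasure (P.map fun ω => X ω + W ω) :=
    Measure.isProbabilityMeasure_map hm.aemeasurable
  have hb : ∀ᵐ x ∂(P.map fun ω => X ω + W ω), ‖x‖ ≤ √(n * c) + R := by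
    rw [ae_map_iff hm.aemeasurable (measurableSet_le (by fun_prop) (by fun_prop))]
    exact h.norm_interference_add_signal_le
  refine ⟨gaussianMixture (P.map fun ω => X ω + W ω) N, measurable_gaussianMixture hb,
    gaussianMixture_pos hN hb, ?_, integrable_log_gaussianMixture_comp hN hb
      h.measurable_sum.aemeasurable (h.memLp_sum.integrable_norm_pow two_ne_zero)⟩
  simp only [← add_assoc]
  exact map_add_eq_withDensity_gaussianMixture hN hm h.measurable_noise
    (h.indep_noise.comp (measurable_fst.add measurable_snd) measurable_id)
    h.norm_interference_add_signal_le h.map_noise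

lemma mutualInfo_output (h : InterferenceModel P N c R X W Z) (hN : N ≠ 0) :
    mutualInfo P X (fun ω => X ω + (W ω + Z ω)) ≠ ∞ ∧
    (mutualInfo P X (fun ω => X ω + (W ω + Z ω))).toReal =
      diffEntropy (P.map fun ω => X ω + (W ω + Z ω)) - diffEntropy (P.map fun ω => W ω + Z ω) := by
  obtain ⟨p, hp, hp0, hplaw, hpint⟩ := h.exists_density_output hN
  obtain ⟨r, hr, hr0, hrlaw, hrint⟩ := h.exists_density_sum hN
  exact mutualInfo_add_eq h.measurable_interference h.measurable_output h.indep_interference hp hp0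
    hplaw hr hr0 hrlaw hpint hrint

lemma map_add_gaussian (h : InterferenceModel P N c R X W Z) {Q : ℝ≥0} (hQ : Q ≠ 0)
    (hYG : Measurable YG) (hlaw : P.map YG = whiteGaussian n Q) (hXYG : IndepFun X YG P) :
    P.map (fun ω => X ω + YG ω) =
      volume.withDensity fun y => ENNReal.ofReal (gaussianMixture (P.map X) Q y) :=
  map_add_eq_withDensity_gaussianMixture hQ h.measurable_interference hYG hXYG
    h.norm_interference_le hlaw

lemma integrable_log_mixture_interference (h : InterferenceModel P N c R X W Z) {Q : ℝ≥0}
    (hQ : Q ≠ 0) {U : Ω → EuclideanSpace ℝ (Fin n)} (hU : MemLp U 2 P) :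
    Integrable (fun ω => Real.log (gaussianMixture (P.map X) Q (U ω))) P := by
  have : IsProbabilityMeasure (P.map X) :=
    Measure.isProbabilityMeasure_map h.measurable_interference.aemeasurable
  exact integrable_log_gaussianMixture_comp hQ h.norm_map_interference_le
    hU.aestronglyMeasurable.aemeasurable (hU.integrable_norm_pow two_ne_zero)

lemma mutualInfo_gaussian (h : InterferenceModel P N c R X W Z) {Q : ℝ≥0} (hQ : Q ≠ 0)
    (hYG : Measurable YG) (hlaw : P.map YG = whiteGaussian n Q) (hXYG : IndepFun X YG P) :
    mutualInfo P X (fun ω => X ω + YG ω) ≠ ∞ ∧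
    (mutualInfo P X (fun ω => X ω + YG ω)).toReal =
      diffEntropy (volume.withDensity fun y => ENNReal.ofReal (gaussianMixture (P.map X) Q y)) -
        diffEntropy (whiteGaussian n Q) := by
  have : IsProbabilityMeasure (P.map X) :=
    Measure.isProbabilityMeasure_map h.measurable_interference.aemeasurable
  have hb := h.norm_map_interference_le
  have hS := h.map_add_gaussian hQ hYG hlaw hXYG
  have hL := memLp_two_of_map_eq_whiteGaussian hYG hlaw
  have hmain := mutualInfo_add_eq h.measurable_interference hYG hXYG
    (continuous_whiteDensity n Q).measurable (whiteDensity_pos n hQ)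
    (by rw [hlaw, whiteGaussian_eq_withDensity n hQ]) (measurable_gaussianMixture hb)
    (gaussianMixture_pos hQ hb) hS
    (integrable_log_whiteDensity_comp hQ hYG.aemeasurable (hL.integrable_norm_pow two_ne_zero))
    (h.integrable_log_mixture_interference hQ (h.memLp_interference.add hL))
  rwa [hS, hlaw] at hmain

lemma exists_knotheCoupling (h : InterferenceModel P N c R X W Z) (hN : N ≠ 0) :
    ∃ YG, IsKnotheCoupling P (fun ω => W ω + Z ω) YG ∧ IndepFun X YG P := by
  have : IsProbabilityMeasure (P.map W) :=
    Measure.isProbabilityMeasure_map h.measurable_signal.aemeasurable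
  have : IsProbabilityMeasure (P.map fun ω => W ω + Z ω) :=
    Measure.isProbabilityMeasure_map h.measurable_output.aemeasurable
  rcases eq_or_ne n 0 with rfl | hn
  -- in dimension `0` the average power is `0 / 0 = 0`, and every vector is Gaussian
  · exact ⟨_, ⟨⟨h.measurable_output, measure_eq_of_subsingleton _ _⟩, id,
      ⟨contDiff_id, fun _ i => i.elim0, fun _ i => i.elim0⟩, ae_of_all _ fun _ => rfl⟩,
      h.indep_interference⟩
  · obtain ⟨F, G, hF, hG, hFG, hmap⟩ := exists_knothe_map hN h.norm_map_signal_le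
      (h.avgPower_ne_zero hN hn)
    refine ⟨fun ω => G (W ω + Z ω), ⟨⟨hG.comp h.measurable_output, ?_⟩, F, hF,
      ae_of_all _ fun ω => (hFG _).symm⟩, h.indep_interference.comp measurable_id hG⟩
    rw [← hmap, ← map_add_eq_withDensity_gaussianMixture hN h.measurable_signal h.measurable_noise
      h.indepFun_signal_noise h.norm_signal_le h.map_noise, Measure.map_map hG h.measurable_output]
    rfl

/-- Under the Knöthe coupling, `E[Y · Y^G]` falls short of its maximum `n Q` by at most `Q` times
the entropy gap `h(Y^G) - h(Y)`. -/
lemma le_integral_inner (h : InterferenceModel P N c R X W Z) (hN : N ≠ 0) (hn : n ≠ 0)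
    (hK : IsKnotheCoupling P (fun ω => W ω + Z ω) YG) :
    (avgPower P fun ω => W ω + Z ω) * (n - (diffEntropy (whiteGaussian n
      (avgPower P fun ω => W ω + Z ω)) - diffEntropy (P.map fun ω => W ω + Z ω))) ≤
      ∫ ω, inner ℝ (W ω + Z ω) (YG ω) ∂P := by
  obtain ⟨⟨hYG, hlaw⟩, F, hF, hae⟩ := hK
  obtain ⟨p, hp, hp0, hplaw, hpint⟩ := h.exists_density_output hN
  have hQ := h.avgPower_ne_zero hN hn
  set Q := avgPower P fun ω => W ω + Z ω
  have hFc := hF.contDiff.continuous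
  have hmap : (whiteGaussian n Q).map F = volume.withDensity fun y => ENNReal.ofReal (p y) := by
    rw [← hlaw, Measure.map_map hFc.measurable hYG, ← hplaw]
    exact Measure.map_congr (hae.mono fun ω hω => hω.symm)
  have hlogm : Measurable fun y => Real.log (p (F y)) := (hp.comp hFc.measurable).log
  have hmain := hF.entropy_le_integral_inner hQ hp hp0 hmap
    (by
      rw [← hlaw, integrable_map_measure (by fun_prop) hYG.aemeasurable]
      refine (h.memLp_output.integrable_norm_pow two_ne_zero).congr (hae.mono fun ω hω => ?_)
      simp only [Function.comp_apply, ← hω])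
    (by
      rw [← hlaw, integrable_map_measure hlogm.aestronglyMeasurable hYG.aemeasurable]
      refine hpint.congr (hae.mono fun ω hω => ?_)
      simp only [Function.comp_apply, ← hω])
  have h1 : ∫ y, Real.log (p (F y)) ∂(whiteGaussian n Q) = ∫ ω, Real.log (p (W ω + Z ω)) ∂P := by
    rw [← hlaw, integral_map hYG.aemeasurable hlogm.aestronglyMeasurable]
    exact integral_congr_ae (hae.mono fun ω hω => by simp only [← hω])
  have h2 : ∫ y, inner ℝ (F y) y ∂(whiteGaussian n Q) =
      ∫ ω, inner ℝ (W ω + Z ω) (YG ω) ∂P := by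
    rw [← hlaw, integral_map hYG.aemeasurable (by fun_prop)]
    exact integral_congr_ae (hae.mono fun ω hω => by simp only [← hω])
  have h3 : diffEntropy (whiteGaussian n Q) =
      -∫ y, Real.log (whiteDensity n Q y) ∂(whiteGaussian n Q) := by
    rw [whiteGaussian_eq_withDensity n hQ]
    exact diffEntropy_withDensity (continuous_whiteDensity n Q).measurable
      fun y => (whiteDensity_pos n hQ y).le
  rw [h1, h2] at hmain
  rw [h3, diffEntropy_map_eq h.measurable_output hp (fun y => (hp0 y).le) hplaw]
  refine Eq.trans_le ?_ hmain
  ring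

/-- Under the Knöthe coupling, `1 - ρ(Y, Y^G)` is at most the entropy gap per dimension. -/
lemma one_sub_corrCoeff_le (h : InterferenceModel P N c R X W Z) (hN : N ≠ 0) (hn : n ≠ 0)
    (hK : IsKnotheCoupling P (fun ω => W ω + Z ω) YG) {ε : ℝ}
    (hε : diffEntropy (whiteGaussian n (avgPower P fun ω => W ω + Z ω)) ≤
      diffEntropy (P.map fun ω => W ω + Z ω) + n * ε) :
    1 - corrCoeff P (fun ω => W ω + Z ω) YG ≤ ε := by
  have hn' : (0 : ℝ) < n := by positivity
  have hQ : (0 : ℝ) < avgPower P fun ω => W ω + Z ω :=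
    NNReal.coe_pos.2 (pos_iff_ne_zero.2 (h.avgPower_ne_zero hN hn))
  have h1 := h.le_integral_inner hN hn hK
  rw [corrCoeff, integral_norm_sq_of_map_eq_whiteGaussian hK.1.1 hK.1.2, ← mul_avgPower hn,
    Real.sqrt_mul_self (by positivity), sub_le_comm, le_div_iff₀ (by positivity)]
  refine le_trans ?_ h1
  have h2 : (1 - ε) * (n * (avgPower P fun ω => W ω + Z ω : ℝ)) =
      (avgPower P fun ω => W ω + Z ω : ℝ) * (n - n * ε) := by ring
  rw [h2]
  gcongr
  linarith

/-- Under the Knöthe coupling, replacing `Y^G` by `Y` changes the expected log-density of `X + Y^G`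
by little: this log-density is locally Lipschitz and `E‖Y - Y^G‖²` is at most `2 n Q ε`. -/
lemma integral_log_mixture_sub_le (h : InterferenceModel P N c R X W Z) (hN : N ≠ 0)
    (hn : n ≠ 0) (hc : 0 ≤ c) (hK : IsKnotheCoupling P (fun ω => W ω + Z ω) YG) {ε : ℝ}
    (hε0 : 0 < ε) (hε : diffEntropy (whiteGaussian n (avgPower P fun ω => W ω + Z ω)) ≤
      diffEntropy (P.map fun ω => W ω + Z ω) + n * ε) :
    ∫ ω, Real.log (gaussianMixture (P.map X) (avgPower P fun ω => W ω + Z ω) (X ω + YG ω)) ∂P -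
      ∫ ω, Real.log (gaussianMixture (P.map X) (avgPower P fun ω => W ω + Z ω)
        (X ω + (W ω + Z ω))) ∂P ≤ n * (√ε * (2 + 12 * c / N)) := by
  have : IsProbabilityMeasure (P.map X) :=
    Measure.isProbabilityMeasure_map h.measurable_interference.aemeasurable
  have hinner := h.le_integral_inner hN hn hK
  have hpow := mul_avgPower (P := P) hn fun ω => W ω + Z ω
  have hNQ := h.le_avgPower hn
  have hQ0 := h.avgPower_ne_zero hN hn
  have hYGpow := integral_norm_sq_of_map_eq_whiteGaussian hK.1.1 hK.1.2
  have hYG := memLp_two_of_map_eq_whiteGaussian hK.1.1 hK.1.2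
  have hY := h.memLp_output
  have hms := h.memLp_sum
  have hb := h.norm_map_interference_le
  have hms' : MemLp (fun ω => X ω + YG ω) 2 P := h.memLp_interference.add hYG
  have hint1 := h.integrable_log_mixture_interference hQ0 hms'
  have hint2 := h.integrable_log_mixture_interference hQ0 hms
  set Q := avgPower P fun ω => W ω + Z ω
  set Y := fun ω => W ω + Z ω
  have hQ : (0 : ℝ) < Q := NNReal.coe_pos.2 (pos_iff_ne_zero.2 hQ0)
  have hNpos : (0 : ℝ) < N := NNReal.coe_pos.2 (pos_iff_ne_zero.2 hN)
  have hs2 : √ε * √ε = ε := Real.mul_self_sqrt hε0.le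
  have hR2 : √(n * c) ^ 2 = n * c := Real.sq_sqrt (by positivity)
  have hIY := hY.integrable_norm_pow two_ne_zero
  have hIYG := hYG.integrable_norm_pow two_ne_zero
  have hII := integrable_inner_of_memLp hY hYG
  have hae : ∀ᵐ ω ∂P, Real.log (gaussianMixture (P.map X) Q (X ω + YG ω)) -
      Real.log (gaussianMixture (P.map X) Q (X ω + (W ω + Z ω))) ≤
      (4 * (Q : ℝ))⁻¹ * ((√ε)⁻¹ * (‖Y ω‖ ^ 2 - 2 * inner ℝ (Y ω) (YG ω) + ‖YG ω‖ ^ 2) +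
        √ε * (3 * (‖Y ω‖ ^ 2 + ‖YG ω‖ ^ 2 + 16 * (n * c)))) := by
    filter_upwards [h.norm_interference_le] with ω hω
    refine (log_gaussianMixture_sub_le hQ0 hb _ _).trans ?_
    rw [add_sub_add_left_eq_sub]
    change ‖Y ω - YG ω‖ * (‖X ω + Y ω‖ + ‖X ω + YG ω‖ + 2 * √(n * c)) / (2 * Q) ≤ _
    rw [← norm_sub_sq_real]
    have h1 : ‖X ω + Y ω‖ + ‖X ω + YG ω‖ + 2 * √(n * c) ≤
        ‖Y ω‖ + ‖YG ω‖ + 4 * √(n * c) := by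
      have := norm_add_le (X ω) (Y ω)
      have := norm_add_le (X ω) (YG ω)
      linarith
    set A := ‖Y ω - YG ω‖
    set B := ‖Y ω‖ + ‖YG ω‖ + 4 * √(n * c) with hB
    have h2 : B ^ 2 ≤ 3 * (‖Y ω‖ ^ 2 + ‖YG ω‖ ^ 2 + 16 * (n * c)) := by
      have h4 : B ^ 2 ≤ 3 * (‖Y ω‖ ^ 2 + ‖YG ω‖ ^ 2 + 16 * √(n * c) ^ 2) := by
        rw [hB]
        nlinarith [sq_nonneg (‖Y ω‖ - ‖YG ω‖), sq_nonneg (‖Y ω‖ - 4 * √(n * c)),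
          sq_nonneg (‖YG ω‖ - 4 * √(n * c))]
      rwa [hR2] at h4
    -- the arithmetic-geometric mean inequality with weight `√ε`
    have h3 : 2 * (A * B) ≤ (√ε)⁻¹ * A ^ 2 + √ε * B ^ 2 := by
      have h4 : (√ε)⁻¹ * A ^ 2 + √ε * B ^ 2 - 2 * (A * B) = (√ε)⁻¹ * (A - √ε * B) ^ 2 := by
        field_simp
        ring
      have h5 : 0 ≤ (√ε)⁻¹ * (A - √ε * B) ^ 2 := by positivity
      linarith
    calc A * (‖X ω + Y ω‖ + ‖X ω + YG ω‖ + 2 * √(n * c)) / (2 * Q)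
        ≤ A * B / (2 * Q) := by gcongr
      _ = (4 * (Q : ℝ))⁻¹ * (2 * (A * B)) := by field_simp; ring
      _ ≤ _ := by
        refine mul_le_mul_of_nonneg_left (h3.trans ?_) (by positivity)
        gcongr
  have hgap : ∫ ω, (‖Y ω‖ ^ 2 - 2 * inner ℝ (Y ω) (YG ω) + ‖YG ω‖ ^ 2) ∂P ≤ 2 * (n * Q * ε) := by
    have hJ0 : Integrable (fun ω => ‖Y ω‖ ^ 2 - 2 * inner ℝ (Y ω) (YG ω)) P :=
      hIY.sub (hII.const_mul 2)
    rw [integral_add hJ0 hIYG, integral_sub hIY (hII.const_mul 2),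
      integral_const_mul, hYGpow, ← hpow]
    have h1 : Q * (n - n * ε) ≤ ∫ ω, inner ℝ (Y ω) (YG ω) ∂P := by
      refine le_trans ?_ hinner
      gcongr
      linarith
    linarith
  have hsum : ∫ ω, (3 * (‖Y ω‖ ^ 2 + ‖YG ω‖ ^ 2 + 16 * (n * c))) ∂P =
      3 * (2 * (n * Q) + 16 * (n * c)) := by
    have hJ0 : Integrable (fun ω => ‖Y ω‖ ^ 2 + ‖YG ω‖ ^ 2) P := hIY.add hIYG
    rw [integral_const_mul, integral_add hJ0 (integrable_const _),
      integral_add hIY hIYG, hYGpow, ← hpow]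
    simp
    ring
  have hJ1 : Integrable (fun ω => ‖Y ω‖ ^ 2 - 2 * inner ℝ (Y ω) (YG ω) + ‖YG ω‖ ^ 2) P :=
    (hIY.sub (hII.const_mul 2)).add hIYG
  have hJ2 : Integrable (fun ω => 3 * (‖Y ω‖ ^ 2 + ‖YG ω‖ ^ 2 + 16 * (n * c))) P :=
    ((hIY.add hIYG).add (integrable_const _)).const_mul 3
  rw [← integral_sub hint1 hint2]
  refine (integral_mono_ae (hint1.sub hint2)
    (((hJ1.const_mul _).add (hJ2.const_mul _)).const_mul _) hae).trans ?_
  rw [integral_const_mul, integral_add' (hJ1.const_mul _) (hJ2.const_mul _), integral_const_mul,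
    integral_const_mul, hsum]
  calc (4 * (Q : ℝ))⁻¹ * ((√ε)⁻¹ * ∫ ω, (‖Y ω‖ ^ 2 - 2 * inner ℝ (Y ω) (YG ω) + ‖YG ω‖ ^ 2) ∂P +
        √ε * (3 * (2 * (n * Q) + 16 * (n * c))))
      ≤ (4 * (Q : ℝ))⁻¹ * ((√ε)⁻¹ * (2 * (n * Q * (√ε * √ε))) +
        √ε * (3 * (2 * (n * Q) + 16 * (n * c)))) := by rw [hs2]; gcongr
    _ = n * (√ε * (2 + 12 * c / Q)) := by field_simp; ring
    _ ≤ n * (√ε * (2 + 12 * c / N)) := by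
      gcongr

lemma mutualInfo_output_le (h : InterferenceModel P N c R X W Z) (hN : N ≠ 0)
    (hn : n ≠ 0) (hc : 0 ≤ c) (hYG : Measurable YG)
    (hlaw : P.map YG = whiteGaussian n (avgPower P fun ω => W ω + Z ω)) (hXYG : IndepFun X YG P)
    {ε : ℝ} (hε0 : 0 < ε)
    (hε : diffEntropy (whiteGaussian n (avgPower P fun ω => W ω + Z ω)) ≤
      diffEntropy (P.map fun ω => W ω + Z ω) + n * ε) :
    (mutualInfo P X (fun ω => X ω + (W ω + Z ω))).toReal ≤
      (mutualInfo P X (fun ω => X ω + YG ω)).toReal + n * (ε + √ε * (2 + 12 * c / N)) := by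
  have : IsProbabilityMeasure (P.map X) :=
    Measure.isProbabilityMeasure_map h.measurable_interference.aemeasurable
  -- the given `Y^G` is replaced by the one of the Knöthe coupling, written `T`
  obtain ⟨T, hT, hXT⟩ := h.exists_knotheCoupling hN
  obtain ⟨r, hr, hr0, hrlaw, hrint⟩ := h.exists_density_sum hN
  have hQ := h.avgPower_ne_zero hN hn
  have hb := h.norm_map_interference_le
  have hS := h.map_add_gaussian hQ hT.1.1 hT.1.2 hXT
  have hST : Measurable fun ω => X ω + T ω := h.measurable_interference.add hT.1.1
  have hm := measurable_gaussianMixture (v := avgPower P fun ω => W ω + Z ω) hb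
  have hpos := gaussianMixture_pos hQ hb
  have h1 := diffEntropy_le_neg_integral_log h.measurable_sum hr hr0 hrlaw hm hpos
    (lintegral_eq_one_of_map_eq hST hS) hrint
    (h.integrable_log_mixture_interference hQ h.memLp_sum)
  have h2 := diffEntropy_map_eq hST hm (fun y => (hpos y).le) hS
  have h3 := h.integral_log_mixture_sub_le hN hn hc hT hε0 hε
  -- `I(X; X + Y^G)` does not depend on the choice of `Y^G`, as long as it is independent of `X`
  rw [(h.mutualInfo_output hN).2, (h.mutualInfo_gaussian hQ hYG hlaw hXYG).2, ← hS, h2, mul_add]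
  linarith

lemma mutualInfo_gaussianVersion_ne_top (h : InterferenceModel P N c R X W Z) (hN : N ≠ 0)
    (hYG : IsWhiteGaussianVersion P (fun ω => W ω + Z ω) YG) (hXYG : IndepFun X YG P) :
    mutualInfo P X (fun ω => X ω + YG ω) ≠ ∞ := by
  rcases eq_or_ne n 0 with rfl | hn
  · have hX := h.measurable_interference
    have hS : Measurable fun ω => X ω + YG ω := hX.add hYG.1
    have : IsProbabilityMeasure (P.map X) := Measure.isProbabilityMeasure_map hX.aemeasurable
    have : IsProbabilityMeasure (P.map fun ω => X ω + YG ω) :=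
      Measure.isProbabilityMeasure_map hS.aemeasurable
    have : IsProbabilityMeasure (P.map fun ω => (X ω, X ω + YG ω)) :=
      Measure.isProbabilityMeasure_map (hX.prodMk hS).aemeasurable
    rw [mutualInfo, measure_eq_of_subsingleton (P.map fun ω => (X ω, X ω + YG ω))
      ((P.map X).prod (P.map fun ω => X ω + YG ω)), InformationTheory.klDiv_self]
    exact ENNReal.zero_ne_top
  · exact (h.mutualInfo_gaussian (h.avgPower_ne_zero hN hn) hYG.1 hYG.2 hXYG).1

end InterferenceModel

/-! ### Almost Gaussian sequences -/

theorem proposition3 (a P₁ P₂ : ℝ) (N : ℝ≥0) (ha : 0 ≤ a) (hN : 0 < N)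
    {Ω : ℕ → Type*} [∀ n, MeasurableSpace (Ω n)]
    (P : ∀ n, Measure (Ω n)) [∀ n, IsProbabilityMeasure (P n)]
    (X₁ X₂ Z X Y : ∀ n, Ω n → EuclideanSpace ℝ (Fin n))
    (hX₁ : ∀ n, Measurable (X₁ n)) (hX₂ : ∀ n, Measurable (X₂ n)) (hZ : ∀ n, Measurable (Z n))
    (hindep : ∀ n, iIndepFun ![X₁ n, X₂ n, Z n] (P n))
    (hmean₁ : ∀ n, ∫ ω, X₁ n ω ∂(P n) = 0) (hmean₂ : ∀ n, ∫ ω, X₂ n ω ∂(P n) = 0)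
    (hpow₁ : ∀ n, ∀ᵐ ω ∂(P n), ‖X₁ n ω‖ ^ 2 ≤ n * P₁)
    (hpow₂ : ∀ n, ∀ᵐ ω ∂(P n), ‖X₂ n ω‖ ^ 2 ≤ n * P₂)
    (hZlaw : ∀ n, (P n).map (Z n) = whiteGaussian n N)
    (hX : ∀ n ω, X n ω = √a • X₁ n ω) (hY : ∀ n ω, Y n ω = X₂ n ω + Z n ω)
    (hAG : AlmostGaussian P Y) :
    -- a Knöthe coupling exists in every dimension, and it is independent of the interference
    (∀ n, ∃ YG : Ω n → EuclideanSpace ℝ (Fin n),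
      IsKnotheCoupling (P n) (Y n) YG ∧ IndepFun (X n) YG (P n)) ∧
    -- under that coupling, `Y` and `Y^G` are almost linearly dependent, with `ρ` close to `1`
    (∀ YG : ∀ n, Ω n → EuclideanSpace ℝ (Fin n),
      (∀ n, IsKnotheCoupling (P n) (Y n) (YG n)) →
      AlmostLinearlyDependent P Y YG ∧
      ∃ ε : ℕ → ℝ, (∀ n, 0 < ε n) ∧ Tendsto ε atTop (𝓝 0) ∧
        ∀ n, 1 ≤ n → 1 - corrCoeff (P n) (Y n) (YG n) ≤ ε n) ∧
    -- `I(X;X+Y) ≲ I(X;X+Y^G)`, both finite, for `Y^G` independent of `X`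
    (∀ YG : ∀ n, Ω n → EuclideanSpace ℝ (Fin n),
      (∀ n, IsWhiteGaussianVersion (P n) (Y n) (YG n)) →
      (∀ n, IndepFun (X n) (YG n) (P n)) →
      (∀ n, mutualInfo (P n) (X n) (fun ω => X n ω + Y n ω) ≠ ∞ ∧
        mutualInfo (P n) (X n) (fun ω => X n ω + YG n ω) ≠ ∞) ∧
      AlmostLE (fun n => (mutualInfo (P n) (X n) (fun ω => X n ω + Y n ω)).toReal)
        (fun n => (mutualInfo (P n) (X n) (fun ω => X n ω + YG n ω)).toReal)) := by
  obtain rfl : Y = fun n ω => X₂ n ω + Z n ω := funext fun n => funext fun ω => hY n ω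
  have hN0 : N ≠ 0 := hN.ne'
  have hm : ∀ n i, Measurable (![X₁ n, X₂ n, Z n] i) := fun n i => by
    fin_cases i
    exacts [hX₁ n, hX₂ n, hZ n]
  have hXeq : ∀ n, X n = fun ω => √a • X₁ n ω := fun n => funext (hX n)
  -- `|P₁|` makes the bound nonnegative without a case distinction; it equals `P₁` here
  have hM : ∀ n, InterferenceModel (P n) N (a * |P₁|) √(n * P₂) (X n) (X₂ n) (Z n) := fun n => by
    have hXn : Measurable (X n) := by
      rw [hXeq]
      exact (hX₁ n).const_smul √a
    have hi1 : IndepFun (fun ω => (X₁ n ω, X₂ n ω)) (Z n) (P n) :=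
      (hindep n).indepFun_prodMk (hm n) 0 1 2 (by decide) (by decide)
    have hi2 : IndepFun (X₁ n) (fun ω => (X₂ n ω, Z n ω)) (P n) :=
      ((hindep n).indepFun_prodMk (hm n) 1 2 0 (by decide) (by decide)).symm
    refine ⟨hXn, hX₂ n, hZ n, ?_, ?_, ?_, ?_, hmean₂ n, hZlaw n⟩
    · rw [hXeq]
      exact hi1.comp (φ := fun x : EuclideanSpace ℝ (Fin n) × EuclideanSpace ℝ (Fin n) =>
        (√a • x.1, x.2)) (by fun_prop) measurable_id
    · rw [hXeq]
      exact hi2.comp (φ := fun x : EuclideanSpace ℝ (Fin n) => √a • x)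
        (ψ := fun x : EuclideanSpace ℝ (Fin n) × EuclideanSpace ℝ (Fin n) => x.1 + x.2)
        (by fun_prop) (by fun_prop)
    · filter_upwards [hpow₁ n] with ω hω
      refine Real.le_sqrt_of_sq_le ?_
      rw [hX, norm_smul, mul_pow, Real.norm_eq_abs, sq_abs, Real.sq_sqrt ha]
      calc a * ‖X₁ n ω‖ ^ 2 ≤ a * (n * |P₁|) := by
            gcongr
            exact hω.trans (by gcongr; exact le_abs_self P₁)
        _ = n * (a * |P₁|) := by ring
    · filter_upwards [hpow₂ n] with ω hω
      exact Real.le_sqrt_of_sq_le hω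
  obtain ⟨ε, hε0, hεlim, hε⟩ := hAG
  refine ⟨fun n => (hM n).exists_knotheCoupling hN0, fun YG hK => ?_, fun YG hYG hXYG => ⟨?_, ?_⟩⟩
  · have hρ : ∀ n, 1 ≤ n → 1 - corrCoeff (P n) (fun ω => X₂ n ω + Z n ω) (YG n) ≤ ε n :=
      fun n hn => (hM n).one_sub_corrCoeff_le hN0 (Nat.one_le_iff_ne_zero.1 hn) (hK n) (hε n hn)
    refine ⟨⟨ε, hε0, hεlim, fun n hn => ?_⟩, ε, hε0, hεlim, hρ⟩
    exact (sub_le_sub_left (le_abs_self _) _).trans (hρ n hn)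
  · exact fun n => ⟨((hM n).mutualInfo_output hN0).1,
      (hM n).mutualInfo_gaussianVersion_ne_top hN0 (hYG n) (hXYG n)⟩
  · refine ⟨fun n => ε n + √(ε n) * (2 + 12 * (a * |P₁|) / N), fun n => ?_, ?_, fun n hn => ?_⟩
    · have := hε0 n
      positivity
    · have hsqrt : Tendsto (fun n => √(ε n)) atTop (𝓝 0) := by
        simpa [Function.comp_def] using (Real.continuous_sqrt.tendsto 0).comp hεlim
      simpa using hεlim.add (hsqrt.mul_const (2 + 12 * (a * |P₁|) / N))
    · exact (hM n).mutualInfo_output_le hN0 (Nat.one_le_iff_ne_zero.1 hn) (by positivity)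
        (hYG n).1 (hYG n).2 (hXYG n) (hε0 n) (hε n hn)
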